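/- Let $\mathbb K$ be $\mathbb R$ or $\mathbb C$. Write $X_p=\ell_p$ for $1\le p<\infty$ and $X_\infty=c_0$ (scalar sequences), $(e_i)_{i\ge1}$ for the canonical unit vectors, $|1/\mathbf r|=\sum_i 1/r_i$ for a finite family $\mathbf r$ of exponents in $[1,\infty]$ (with $1/\infty=0$), and $\|T\|$ for the usual (sup) norm of a continuous multilinear form $T$. **Optimal constants.** For $\mathbf r\in[1,\infty]^k$ and $\mathbf q=(q_1,\dots,q_k)\in[1,2]^k$, let $C^{\mathbb K}_{k,\mathbf r,\mathbf q}\in[0,\infty]$ be the least constant $C$ such that $$\Big(\sum_{i_1=1}^\infty\Big(\cdots\Big(\sum_{i_k=1}^\infty|A(e_{i_1},\dots,e_{i_k})|^{q_k}\Big)^{\frac{q_{k-1}}{q_k}}\cdots\Big)^{\frac{q_1}{q_2}}\Big)^{\frac1{q_1}}\le C\,\|A\|$$ for all continuous $k$-linear forms $A:X_{r_1}\times\cdots\times X_{r_k}\to\mathbb K$. For $\mathbf r\in[1,\infty]^k$ with $|1/\mathbf r|<1$, let $D^{\mathbb K}_{k,\mathbf r}\in[0,\infty]$ be the least constant $D$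 such that $$\Big(\sum_{i_1,\dots,i_k=1}^N|A(e_{i_1},\dots,e_{i_k})|^{\frac1{1-|1/\mathbf r|}}\Big)^{1-|1/\mathbf r|}\le D\,\|A\|$$ for all $N\ge1$ and all $k$-linear forms $A:\ell_{r_1}^N\times\cdots\times\ell_{r_k}^N\to\mathbb K$. **Theorem.** Let $k\ge1$, let $n_1,\dots,n_k\ge1$ be integers, $m=n_1+\cdots+n_k$, let $p_1,\dots,p_k\in[1,\infty]$, and let $$\mathbf p=(\underbrace{p_1,\dots,p_1}_{n_1},\dots,\underbrace{p_k,\dots,p_k}_{n_k})\in[1,\infty]^m.$$ For a continuous $m$-linear form $T:X_{p_1}^{n_1}\times\cdots\times X_{p_k}^{n_k}\to\mathbb K$ (the space $X_{p_j}$ occurring $n_j$ times) let $T(e_{i_1}^{n_1},\dots,e_{i_k}^{n_k})$ denote the value of $T$ at the point in which $e_{i_1}$ is repeated $n_1$ times, ..., $e_{i_k}$ is repeated $n_k$ times. 1. If $|1/\mathbf p|\le\frac12$ and $\mathbf q\in\big[(1-|1/\mathbf p|)^{-1},2\big]^k$ satisfies $\frac1{q_1}+\cdots+\frac1{q_k}\le\frac{k+1}2-|1/\mathbf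 p|$, then $1\le C^{\mathbb K}_{k,(p_1/n_1,\dots,p_k/n_k),\mathbf q}<\infty$ and, for all continuous $m$-linear forms $T$ as above, $$\Big(\sum_{i_1=1}^\infty\Big(\cdots\Big(\sum_{i_k=1}^\infty|T(e_{i_1}^{n_1},\dots,e_{i_k}^{n_k})|^{q_k}\Big)^{\frac{q_{k-1}}{q_k}}\cdots\Big)^{\frac{q_1}{q_2}}\Big)^{\frac1{q_1}}\le C^{\mathbb K}_{k,(p_1/n_1,\dots,p_k/n_k),\mathbf q}\,\|T\|.$$ 2. If $\frac12\le|1/\mathbf p|<1$, then $1\le D^{\mathbb K}_{k,(p_1/n_1,\dots,p_k/n_k)}<\infty$ and, for all continuous $m$-linear forms $T$ as above, $$\Big(\sum_{i_1,\dots,i_k=1}^\infty|T(e_{i_1}^{n_1},\dots,e_{i_k}^{n_k})|^{\frac1{1-|1/\mathbf p|}}\Big)^{1-|1/\mathbf p|}\le D^{\mathbb K}_{k,(p_1/n_1,\dots,p_k/n_k)}\,\|T\|.$$ Moreover, the exponent is optimal: $\frac1{1-|1/\mathbf p|}$ is the least $s>0$ for which there is a finite constant $K$ with $\big(\sum_{i_1,\dots,i_k=1}^\infty|T(e_{i_1}^{n_1},\dots,e_{i_k}^{n_k})|^s\big)^{1/s}\le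 K\|T\|$ for all continuous $m$-linear forms $T$ as above. -/

import Mathlib

open scoped ENNReal

namespace HardyLittlewood

/-- The quantity `|1/p| = ∑ᵢ 1/pᵢ` of a finite family of exponents in `[1, ∞]`
(with `1/∞ = 0`). -/
noncomputable def absInv {ι : Type*} [Fintype ι] (p : ι → ℝ≥0∞) : ℝ :=
  ∑ i, ((p i)⁻¹).toReal

/-- The space `X_p`: it is `ℓ_p` for `p < ∞`, and `c₀` with the sup norm for `p = ∞`. -/
def X (𝕜 : Type*) [RCLike 𝕜] (p : ℝ≥0∞) [Fact (1 ≤ p)] :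
    Submodule 𝕜 (lp (fun _ : ℕ => 𝕜) p) where
  carrier := {x | p = ∞ → Filter.Tendsto (fun i => x i) Filter.atTop (nhds 0)}
  zero_mem' := by
    intro _
    simp
  add_mem' := by
    intro x y hx hy hp
    simpa using (hx hp).add (hy hp)
  smul_mem' := by
    intro c x hx hp
    simpa using (hx hp).const_mul c

/-- The canonical unit vector `e_i` of `X_p`. -/
noncomputable def X.e {𝕜 : Type*} [RCLike 𝕜] {p : ℝ≥0∞} [Fact (1 ≤ p)] (i : ℕ) : X 𝕜 p :=
  ⟨lp.single p i (1 : 𝕜), by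
    intro _
    refine tendsto_const_nhds.congr' ?_
    filter_upwards [Filter.eventually_gt_atTop i] with j hj
    simp [lp.single_apply, hj.ne']⟩

/-- The iterated (mixed) sum
`(∑_{i₁} (⋯ (∑_{i_k} f(i₁, …, i_k)^{q_k})^{q_{k-1}/q_k} ⋯)^{q₁/q₂})^{1/q₁}`
of a nonnegative family, with values in `[0, ∞]`. -/
noncomputable def mixedSum : {k : ℕ} → (Fin k → ℝ) → ((Fin k → ℕ) → ℝ≥0∞) → ℝ≥0∞
  | 0, _, f => f Fin.elim0
  | _ + 1, q, f =>
    (∑' i : ℕ, mixedSum (Fin.tail q) (fun v => f (Fin.cons i v)) ^ q 0) ^ (1 / q 0)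

/-- `C_{k,r,q}`: the optimal (least) constant `C ∈ [0, ∞]` such that the `q`-mixed sum of
`|A(e_{i₁}, …, e_{i_k})|` is at most `C ‖A‖` for all continuous `k`-linear forms
`A : X_{r₁} × ⋯ × X_{r_k} → 𝕜`. It is only meant for `r ∈ [1, ∞]^k`. -/
noncomputable def constC (𝕜 : Type*) [RCLike 𝕜] {k : ℕ} (r : Fin k → ℝ≥0∞) (q : Fin k → ℝ) :
    ℝ≥0∞ :=
  sInf {C : ℝ≥0∞ | ∀ [∀ j, Fact (1 ≤ r j)]
    (A : ContinuousMultilinearMap 𝕜 (fun j : Fin k => X 𝕜 (r j)) 𝕜),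
      mixedSum q (fun i => ‖A (fun j => X.e (i j))‖ₑ) ≤ C * ‖A‖ₑ}

/-- `D_{k,r}`: the optimal (least) constant `D ∈ [0, ∞]` such that
`(∑ |A(e_{i₁}, …, e_{i_k})|^{1/(1-|1/r|)})^{1-|1/r|} ≤ D ‖A‖` for all `N ≥ 1` and all
`k`-linear forms `A : ℓ_{r₁}^N × ⋯ × ℓ_{r_k}^N → 𝕜`. It is only meant for `r ∈ [1, ∞]^k`
with `|1/r| < 1`. -/
noncomputable def constD (𝕜 : Type*) [RCLike 𝕜] {k : ℕ} (r : Fin k → ℝ≥0∞) : ℝ≥0∞ :=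
  sInf {D : ℝ≥0∞ | ∀ [∀ j, Fact (1 ≤ r j)] (N : ℕ), 0 < N →
    ∀ A : ContinuousMultilinearMap 𝕜 (fun j : Fin k => PiLp (r j) (fun _ : Fin N => 𝕜)) 𝕜,
      (∑ i : Fin k → Fin N,
          ‖A (fun j => WithLp.toLp (r j) (Pi.single (i j) (1 : 𝕜)))‖ₑ ^ (1 / (1 - absInv r)))
        ^ (1 - absInv r) ≤ D * ‖A‖ₑ}

/-- The exponents `(p₁, …, p₁, …, p_k, …, p_k)`, with `p_j` repeated `n_j` times; the
`n₁ + ⋯ + n_k` coordinates are indexed by the pairs (block, position in the block). -/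
abbrev blockExp {k : ℕ} (n : Fin k → ℕ) (p : Fin k → ℝ≥0∞) : (Σ j : Fin k, Fin (n j)) → ℝ≥0∞ :=
  fun s => p s.1

/-- The continuous `m`-linear forms on `X_{p₁}^{n₁} × ⋯ × X_{p_k}^{n_k}`, `m = n₁ + ⋯ + n_k`,
with the usual norm. -/
abbrev BlockForm (𝕜 : Type*) [RCLike 𝕜] {k : ℕ} (n : Fin k → ℕ) (p : Fin k → ℝ≥0∞)
    [∀ j, Fact (1 ≤ p j)] : Type _ :=
  ContinuousMultilinearMap 𝕜 (fun s : Σ j : Fin k, Fin (n j) => X 𝕜 (blockExp n p s)) 𝕜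

/-- The value `T(e_{i₁}^{n₁}, …, e_{i_k}^{n_k})`, where `e_{i_j}` is repeated `n_j` times. -/
noncomputable def BlockForm.coeff {𝕜 : Type*} [RCLike 𝕜] {k : ℕ} {n : Fin k → ℕ}
    {p : Fin k → ℝ≥0∞} [∀ j, Fact (1 ≤ p j)] (T : BlockForm 𝕜 n p) (i : Fin k → ℕ) : 𝕜 :=
  T (fun s => X.e (i s.1))

end HardyLittlewood

/-! Put ρ_j = n_j/p_j, R = ∑ρ_j = |1/p| and λ = 1/(1-R). The coefficients T(e_{i₁}^{n₁}, …,
e_{i_k}^{n_k}) are also the coefficients of a k-linear form on the spaces with exponents p_j/n_j,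
and the norm of that form on any finite box is at most ‖T‖ (`FormBound.diagonal`). Averaging over
random signs kills the off-diagonal terms, and a vector u^{ρ} repeated n times turns into u^{nρ}. So
each inequality for T holds with the constant of the k-linear inequality, and it remains to see that
these constants are finite.

For finiteness, Khinchine's inequality gives a weighted (ℓ₁, ℓ₂) estimate in each variable
(`FormBound.sum_sqrt_le`). When R < 1/2, taking the slice sums of |c|² as weights and applying
Hölder twice bounds the (λ, 2)-sums by themselves to a smaller power, which closes up to a bound
√3^k M (`FormBound.sum_sliceSq_le_of_lt`). Diagonal multipliers (`FormBound.twist`) carry this to R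
= 1/2 and then to 1/2 ≤ R < 1. For R ≤ 1/2, Minkowski and interpolation pass from the (λ, 2)-sums to
all admissible mixed exponents (`mixedSum_le_of_slice`).

The form ∑_{x<N} ∏_s v_s(x) has norm at most N^{1-R} and N coefficients equal to 1, which makes the
exponent optimal. The product of first coordinates shows that the constants are at least 1. -/

namespace HardyLittlewood

/-! ### Hölder's inequality for finite families -/

section Holder

variable {ι κ : Type*}

/-- Hölder's inequality for a finite family of nonnegative functions. -/
theorem sum_prod_rpow_le (s : Finset ι) (t : Finset κ) (f : κ → ι → ℝ) (w : κ → ℝ)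
    (hf : ∀ l i, 0 ≤ f l i) (hw : ∀ l ∈ t, 0 ≤ w l) (hw1 : ∑ l ∈ t, w l = 1) :
    ∑ i ∈ s, ∏ l ∈ t, f l i ^ w l ≤ ∏ l ∈ t, (∑ i ∈ s, f l i) ^ w l := by
  have hS : ∀ l, 0 ≤ ∑ i ∈ s, f l i := fun l => Finset.sum_nonneg fun i _ => hf l i
  -- A zero sum cannot be normalised, but with a nonzero weight it makes every summand on the left
  -- vanish.
  by_cases h0 : ∃ l ∈ t, w l ≠ 0 ∧ ∑ i ∈ s, f l i = 0
  · obtain ⟨l, hl, hwl, hl0⟩ := h0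
    rw [Finset.sum_eq_zero]
    · exact Finset.prod_nonneg fun l _ => Real.rpow_nonneg (hS l) _
    · intro i hi
      refine Finset.prod_eq_zero hl ?_
      rw [(Finset.sum_eq_zero_iff_of_nonneg fun i _ => hf l i).1 hl0 i hi, Real.zero_rpow hwl]
  · push Not at h0
    have key : ∀ i ∈ s, ∏ l ∈ t, f l i ^ w l ≤
        (∏ l ∈ t, (∑ i ∈ s, f l i) ^ w l) * ∑ l ∈ t, w l * (f l i / ∑ i ∈ s, f l i) := by
      intro i _
      have := Real.geom_mean_le_arith_mean_weighted t w (fun l => f l i / ∑ i ∈ s, f l i) hw hw1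
        (fun l _ => div_nonneg (hf l i) (hS l))
      refine le_trans (le_of_eq ?_) (mul_le_mul_of_nonneg_left this
        (Finset.prod_nonneg fun l _ => Real.rpow_nonneg (hS l) _))
      rw [← Finset.prod_mul_distrib]
      refine Finset.prod_congr rfl fun l hl => ?_
      by_cases hwl : w l = 0
      · simp [hwl]
      · rw [← Real.mul_rpow (hS l) (div_nonneg (hf l i) (hS l)), mul_div_cancel₀ _ (h0 l hl hwl)]
    refine (Finset.sum_le_sum key).trans ?_
    rw [← Finset.mul_sum, Finset.sum_comm]
    refine mul_le_of_le_one_right (Finset.prod_nonneg fun l _ => Real.rpow_nonneg (hS l) _) ?_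
    rw [← hw1]
    refine Finset.sum_le_sum fun l hl => ?_
    rw [← Finset.mul_sum, ← Finset.sum_div]
    exact mul_le_of_le_one_right (hw l hl) (div_self_le_one _)

/-- Hölder's inequality for a finite family of nonnegative functions and one more function. -/
theorem sum_mul_prod_rpow_le [Fintype κ] (s : Finset ι) (g : ι → ℝ) (f : κ → ι → ℝ) (w₀ : ℝ)
    (w : κ → ℝ) (hg : ∀ i, 0 ≤ g i) (hf : ∀ l i, 0 ≤ f l i) (hw₀ : 0 ≤ w₀) (hw : ∀ l, 0 ≤ w l)
    (hw1 : w₀ + ∑ l, w l = 1) :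
    ∑ i ∈ s, g i ^ w₀ * ∏ l, f l i ^ w l ≤ (∑ i ∈ s, g i) ^ w₀ * ∏ l, (∑ i ∈ s, f l i) ^ w l := by
  have := sum_prod_rpow_le s (Finset.univ : Finset (Option κ)) (fun o => o.elim g f)
    (fun o => o.elim w₀ w) (by rintro (_ | l) i; exacts [hg i, hf l i])
    (by rintro (_ | l) _; exacts [hw₀, hw l]) (by simpa [Fintype.sum_option] using hw1)
  simpa [Fintype.prod_option] using this

end Holder

/-! ### Bounded forms through their coefficients -/

section FormBound

variable {𝕜 : Type*} [RCLike 𝕜] {κ ι : Type*} [Fintype κ] [DecidableEq κ] [Fintype ι]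

/-- The form with coefficients `c` is bounded by `M` on the product of the `ℓ_{1/ρ_j}`: every
vector of `ℓ_{1/ρ}` is written as `ω u ^ ρ` with `|ω| ≤ 1` and `u ≥ 0` summable. -/
def FormBound (ρ : κ → ℝ) (c : (κ → ι) → 𝕜) (M : ℝ) : Prop :=
  ∀ (u : κ → ι → ℝ) (ω : κ → ι → 𝕜), (∀ j x, 0 ≤ u j x) → (∀ j x, ‖ω j x‖ ≤ 1) →
    ‖∑ i : κ → ι, (∏ j, ω j (i j) * ((u j (i j) ^ ρ j : ℝ) : 𝕜)) * c i‖ ≤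
      M * ∏ j, (∑ x, u j x) ^ ρ j

variable {E : Type*} [NormedAddCommGroup E] [NormedSpace 𝕜 E]

/-- The vectors `e` satisfy the upper `ℓ_{1/ρ}` estimate. -/
def UpperEstimate (𝕜 : Type*) [RCLike 𝕜] {E : Type*} [NormedAddCommGroup E] [NormedSpace 𝕜 E]
    (e : ι → E) (ρ : ℝ) : Prop :=
  ∀ (u : ι → ℝ) (ω : ι → 𝕜), (∀ x, 0 ≤ u x) → (∀ x, ‖ω x‖ ≤ 1) →
    ‖∑ x, (ω x * ((u x ^ ρ : ℝ) : 𝕜)) • e x‖ ≤ (∑ x, u x) ^ ρ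

/-- The functionals `φ` satisfy the lower `ℓ_{1/ρ}` estimate. -/
def LowerEstimate (φ : ι → E →L[𝕜] 𝕜) (ρ : ℝ) : Prop :=
  ∀ v : E, ∃ (u : ι → ℝ) (ω : ι → 𝕜), (∀ x, 0 ≤ u x) ∧ (∀ x, ‖ω x‖ ≤ 1) ∧ ∑ x, u x ≤ 1 ∧
    ∀ x, φ x v = (‖v‖ : 𝕜) * (ω x * ((u x ^ ρ : ℝ) : 𝕜))

end FormBound

section Forms

variable {𝕜 : Type*} [RCLike 𝕜] {κ ι : Type*} [Fintype κ] [DecidableEq κ] [Fintype ι]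
  {E : κ → Type*} [∀ j, NormedAddCommGroup (E j)] [∀ j, NormedSpace 𝕜 (E j)]

theorem map_sum_smul (A : ContinuousMultilinearMap 𝕜 E 𝕜) (e : ∀ j, ι → E j)
    (a : κ → ι → 𝕜) :
    A (fun j => ∑ x, a j x • e j x) =
      ∑ i : κ → ι, (∏ j, a j (i j)) * A (fun j => e j (i j)) := by
  rw [ContinuousMultilinearMap.map_sum]
  refine Finset.sum_congr rfl fun i _ => ?_
  rw [ContinuousMultilinearMap.map_smul_univ, smul_eq_mul]

theorem FormBound.of_continuousMultilinearMap (A : ContinuousMultilinearMap 𝕜 E 𝕜)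
    (e : ∀ j, ι → E j) (ρ : κ → ℝ) (he : ∀ j, UpperEstimate 𝕜 (e j) (ρ j)) :
    FormBound ρ (fun i : κ → ι => A fun j => e j (i j)) ‖A‖ := by
  intro u ω hu hω
  rw [← map_sum_smul A e fun j x => ω j x * ((u j x ^ ρ j : ℝ) : 𝕜)]
  refine (A.le_opNorm _).trans (mul_le_mul_of_nonneg_left ?_ (norm_nonneg _))
  exact Finset.prod_le_prod (fun _ _ => norm_nonneg _) fun j _ => he j _ _ (hu j) (hω j)

/-- The multilinear form `∑ c_i ∏ φ_{j, i_j}`. -/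
noncomputable def coordForm (φ : ∀ j, ι → E j →L[𝕜] 𝕜) (c : (κ → ι) → 𝕜) :
    ContinuousMultilinearMap 𝕜 E 𝕜 :=
  ∑ i : κ → ι, c i •
    (ContinuousMultilinearMap.mkPiAlgebra 𝕜 κ 𝕜).compContinuousLinearMap fun j => φ j (i j)

theorem coordForm_apply (φ : ∀ j, ι → E j →L[𝕜] 𝕜) (c : (κ → ι) → 𝕜) (v : ∀ j, E j) :
    coordForm φ c v = ∑ i : κ → ι, (∏ j, φ j (i j) (v j)) * c i := by
  simp [coordForm, sum_apply, mul_comm]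

/-- Each v_j is ‖v_j‖ times a vector ω u^ρ with ∑u ≤ 1, to which the bound applies. Together with
`FormBound.of_continuousMultilinearMap` this transfers coefficients between spaces without loss in
the norm. -/
theorem FormBound.norm_coordForm_le {ρ : κ → ℝ} {c : (κ → ι) → 𝕜} {M : ℝ}
    (h : FormBound ρ c M) (hρ : ∀ j, 0 ≤ ρ j) (hM : 0 ≤ M) (φ : ∀ j, ι → E j →L[𝕜] 𝕜)
    (hφ : ∀ j, LowerEstimate (φ j) (ρ j)) : ‖coordForm φ c‖ ≤ M := by
  refine ContinuousMultilinearMap.opNorm_le_bound hM fun v => ?_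
  choose u ω hu hω hs hv using fun j => hφ j (v j)
  rw [coordForm_apply]
  simp_rw [hv, Finset.prod_mul_distrib (f := fun j => ((‖v j‖ : ℝ) : 𝕜)), mul_assoc]
  rw [← Finset.mul_sum, norm_mul, norm_prod, mul_comm]
  simp only [RCLike.norm_ofReal, abs_norm]
  refine mul_le_mul_of_nonneg_right ?_ (Finset.prod_nonneg fun _ _ => norm_nonneg _)
  have := h u ω hu hω
  refine this.trans (mul_le_of_le_one_right hM ?_)
  exact Finset.prod_le_one (fun j _ => Real.rpow_nonneg (Finset.sum_nonneg fun x _ => hu j x) _)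
    fun j _ => Real.rpow_le_one (Finset.sum_nonneg fun x _ => hu j x) (hs j) (hρ j)

theorem coordForm_basis [DecidableEq ι] (φ : ∀ j, ι → E j →L[𝕜] 𝕜) (c : (κ → ι) → 𝕜)
    (e : ∀ j, ι → E j) (he : ∀ j x y, φ j x (e j y) = if x = y then 1 else 0) (i : κ → ι) :
    coordForm φ c (fun j => e j (i j)) = c i := by
  rw [coordForm_apply, Finset.sum_eq_single i]
  · simp [he]
  · intro b _ hb
    obtain ⟨j, hj⟩ := Function.ne_iff.1 hb
    rw [Finset.prod_eq_zero (Finset.mem_univ j) (by simp [he, hj]), zero_mul]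
  · simp

end Forms

/-! ### The spaces X_p and finite-dimensional ℓ_p -/

section Spaces

variable {𝕜 : Type*} [RCLike 𝕜]

theorem toReal_pos_of_fact {p : ℝ≥0∞} [hp : Fact (1 ≤ p)] (h : p ≠ ∞) : 0 < p.toReal :=
  ENNReal.toReal_pos (zero_lt_one.trans_le hp.out).ne' h

theorem exists_unimodular_mul_rpow {ι : Type*} [Fintype ι] (p : ℝ≥0∞) [hp : Fact (1 ≤ p)]
    (v : ι → 𝕜) (t : ℝ) (ht : 0 ≤ t) (hv : ∀ x, ‖v x‖ ≤ t)
    (hs : p ≠ ∞ → ∑ x, ‖v x‖ ^ p.toReal ≤ t ^ p.toReal) :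
    ∃ (u : ι → ℝ) (ω : ι → 𝕜), (∀ x, 0 ≤ u x) ∧ (∀ x, ‖ω x‖ ≤ 1) ∧ ∑ x, u x ≤ 1 ∧
      ∀ x, v x = (t : 𝕜) * (ω x * ((u x ^ (p⁻¹).toReal : ℝ) : 𝕜)) := by
  rcases ht.eq_or_lt with rfl | ht
  · exact ⟨0, 0, by simp, by simp, by simp, fun x => by simpa using hv x⟩
  have ht' : (t : 𝕜) ≠ 0 := RCLike.ofReal_ne_zero.2 ht.ne'
  by_cases h : p = ∞
  -- For p = ∞ the exponent is 0 and `0 ^ 0 = 1`, so u = 0 works and ω carries the whole vector.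
  · refine ⟨0, fun x => v x / t, by simp, fun x => ?_, by simp, fun x => ?_⟩
    · rw [norm_div, RCLike.norm_ofReal, abs_of_pos ht]
      exact div_le_one_of_le₀ (hv x) ht.le
    · simp [h, mul_div_cancel₀ _ ht']
  · have hp0 := toReal_pos_of_fact h
    refine ⟨fun x => (‖v x‖ / t) ^ p.toReal, fun x => v x / (‖v x‖ : 𝕜), fun x => by positivity,
      fun x => ?_, ?_, fun x => ?_⟩
    · rw [norm_div, RCLike.norm_ofReal, abs_norm]
      exact div_self_le_one _
    · simp_rw [Real.div_rpow (norm_nonneg _) ht.le]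
      rw [← Finset.sum_div]
      exact div_le_one_of_le₀ (hs h) (by positivity)
    · rw [ENNReal.toReal_inv, Real.rpow_rpow_inv (by positivity) hp0.ne']
      by_cases hx : v x = 0
      · simp [hx]
      · have : (‖v x‖ : 𝕜) ≠ 0 := RCLike.ofReal_ne_zero.2 (norm_ne_zero_iff.2 hx)
        push_cast
        field_simp

/-- The coordinate functionals of `X_p`. -/
noncomputable def X.coord (𝕜 : Type*) [RCLike 𝕜] (p : ℝ≥0∞) [Fact (1 ≤ p)] (i : ℕ) :
    X 𝕜 p →L[𝕜] 𝕜 :=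
  (lp.evalCLM 𝕜 (fun _ : ℕ => 𝕜) p i).comp (X 𝕜 p).subtypeL

theorem X.coord_apply (p : ℝ≥0∞) [Fact (1 ≤ p)] (i : ℕ) (v : X 𝕜 p) :
    X.coord 𝕜 p i v = v.1 i := rfl

theorem X.coord_e (p : ℝ≥0∞) [Fact (1 ≤ p)] (i j : ℕ) :
    X.coord 𝕜 p i (X.e j) = if i = j then 1 else 0 := by
  rw [X.coord_apply]
  simp [X.e, lp.single_apply, Pi.single_apply]

theorem X.lowerEstimate (p : ℝ≥0∞) [hp : Fact (1 ≤ p)] (N : ℕ) :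
    LowerEstimate (fun x : Fin N => X.coord 𝕜 p x) (p⁻¹).toReal := by
  intro v
  refine exists_unimodular_mul_rpow p (fun x : Fin N => X.coord 𝕜 p x v) ‖v‖ (norm_nonneg _)
    (fun x => lp.norm_apply_le_norm (zero_lt_one.trans_le hp.out).ne' v.1 x) fun h => ?_
  have := lp.sum_rpow_le_norm_rpow (toReal_pos_of_fact h) v.1 (Finset.range N)
  rw [Finset.sum_range] at this
  exact this

theorem norm_mul_rpow_le {ω : 𝕜} {u ρ : ℝ} (hu : 0 ≤ u) (hω : ‖ω‖ ≤ 1) :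
    ‖ω * ((u ^ ρ : ℝ) : 𝕜)‖ ≤ u ^ ρ := by
  rw [norm_mul, RCLike.norm_ofReal, abs_of_nonneg (by positivity)]
  exact mul_le_of_le_one_left (by positivity) hω

theorem sum_norm_rpow_le {ι : Type*} [Fintype ι] (p : ℝ≥0∞) [Fact (1 ≤ p)] (h : p ≠ ∞)
    {u : ι → ℝ} {ω : ι → 𝕜} (hu : ∀ x, 0 ≤ u x) (hω : ∀ x, ‖ω x‖ ≤ 1) :
    ∑ x, ‖ω x * ((u x ^ (p⁻¹).toReal : ℝ) : 𝕜)‖ ^ p.toReal ≤ ∑ x, u x := by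
  have hp0 := toReal_pos_of_fact h
  refine Finset.sum_le_sum fun x _ => ?_
  refine (Real.rpow_le_rpow (norm_nonneg _) (norm_mul_rpow_le (hu x) (hω x)) hp0.le).trans ?_
  rw [ENNReal.toReal_inv, Real.rpow_inv_rpow (hu x) hp0.ne']

theorem X.upperEstimate (p : ℝ≥0∞) [hp : Fact (1 ≤ p)] (N : ℕ) :
    UpperEstimate 𝕜 (fun x : Fin N => (X.e (x : ℕ) : X 𝕜 p)) (p⁻¹).toReal := by
  intro u ω hu hω
  set a : Fin N → 𝕜 := fun x => ω x * ((u x ^ (p⁻¹).toReal : ℝ) : 𝕜) with ha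
  change ‖∑ x, a x • (X.e (x : ℕ) : X 𝕜 p)‖ ≤ _
  have hsum : ((∑ x, a x • (X.e (x : ℕ) : X 𝕜 p) : X 𝕜 p) : lp (fun _ : ℕ => 𝕜) p) =
      ∑ x : Fin N, lp.single p (x : ℕ) (a x) := by
    rw [Submodule.coe_sum]
    refine Finset.sum_congr rfl fun x _ => ?_
    rw [Submodule.coe_smul]
    change a x • lp.single (E := fun _ : ℕ => 𝕜) p (x : ℕ) (1 : 𝕜) = _
    rw [← lp.single_smul, smul_eq_mul, mul_one]
  change ‖((∑ x, a x • (X.e (x : ℕ) : X 𝕜 p) : X 𝕜 p) : lp (fun _ : ℕ => 𝕜) p)‖ ≤ _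
  rw [hsum]
  by_cases h : p = ∞
  · subst h
    simp only [ENNReal.inv_top, ENNReal.toReal_zero, Real.rpow_zero]
    refine lp.norm_le_of_forall_le zero_le_one fun i => ?_
    rw [lp.coeFn_sum, Finset.sum_apply]
    by_cases hi : i < N
    · rw [Finset.sum_eq_single ⟨i, hi⟩]
      · simpa [lp.single_apply, ha] using hω _
      · intro b _ hb
        rw [lp.single_apply_ne]
        rintro rfl
        exact hb rfl
      · simp
    · rw [Finset.sum_eq_zero]
      · simp
      · intro b _
        rw [lp.single_apply_ne]
        rintro rfl
        exact hi b.2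
  · have hp0 := toReal_pos_of_fact h
    have := lp.norm_sum_single hp0 (fun i => if h : i < N then a ⟨i, h⟩ else 0) (Finset.range N)
    rw [Finset.sum_range, Finset.sum_range] at this
    simp only [Fin.is_lt, dite_true, Fin.eta] at this
    rw [ENNReal.toReal_inv, Real.le_rpow_inv_iff_of_pos (norm_nonneg _)
      (Finset.sum_nonneg fun x _ => hu x) hp0, this]
    exact sum_norm_rpow_le p h hu hω

theorem PiLp.lowerEstimate {ι : Type*} [Fintype ι] (p : ℝ≥0∞) [hp : Fact (1 ≤ p)] :
    LowerEstimate (fun x : ι => PiLp.proj p (fun _ : ι => 𝕜) (𝕜 := 𝕜) x) (p⁻¹).toReal := by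
  intro v
  refine exists_unimodular_mul_rpow p (fun x : ι => v x) ‖v‖ (norm_nonneg _)
    (fun x => PiLp.norm_apply_le v x) fun h => ?_
  have hp0 := toReal_pos_of_fact h
  rw [PiLp.norm_eq_sum hp0, one_div, Real.rpow_inv_rpow (by positivity) hp0.ne']

theorem PiLp.upperEstimate {ι : Type*} [Fintype ι] [DecidableEq ι] (p : ℝ≥0∞)
    [hp : Fact (1 ≤ p)] :
    UpperEstimate 𝕜 (fun x : ι => WithLp.toLp p (Pi.single x (1 : 𝕜) : ι → 𝕜))
      (p⁻¹).toReal := by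
  intro u ω hu hω
  have hsum : ∑ x, (ω x * ((u x ^ (p⁻¹).toReal : ℝ) : 𝕜)) •
      WithLp.toLp p (Pi.single x (1 : 𝕜) : ι → 𝕜) =
      WithLp.toLp p fun x => ω x * ((u x ^ (p⁻¹).toReal : ℝ) : 𝕜) := by
    ext y
    simp [Pi.single_apply]
  rw [hsum]
  by_cases h : p = ∞
  · subst h
    simp only [ENNReal.inv_top, ENNReal.toReal_zero, Real.rpow_zero]
    rw [PiLp.norm_toLp, pi_norm_le_iff_of_nonneg zero_le_one]
    simpa using hω
  · have hp0 := toReal_pos_of_fact h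
    rw [PiLp.norm_eq_sum hp0, ENNReal.toReal_inv, one_div]
    refine Real.rpow_le_rpow (by positivity) ?_ (by positivity)
    simpa only [ENNReal.toReal_inv] using sum_norm_rpow_le p h hu hω

end Spaces

/-! ### Orthogonality of random signs -/

section Signs

variable {𝕜 : Type*} [RCLike 𝕜]

/-- A sign as a scalar. -/
def sgn (𝕜 : Type*) [RCLike 𝕜] (e : ℤˣ) : 𝕜 := ((e : ℤ) : 𝕜)

theorem sgn_mul (a b : ℤˣ) : sgn 𝕜 (a * b) = sgn 𝕜 a * sgn 𝕜 b := by simp [sgn]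

@[simp] theorem norm_sgn (a : ℤˣ) : ‖sgn 𝕜 a‖ = 1 := by
  rcases Int.units_eq_one_or a with rfl | rfl <;> simp [sgn]

@[simp] theorem sgn_mul_self (a : ℤˣ) : sgn 𝕜 a * sgn 𝕜 a = 1 := by
  rw [← sgn_mul, Int.units_mul_self]; simp [sgn]

theorem sum_sgn_mul_sgn {ι : Type*} [Fintype ι] [DecidableEq ι] (x y : ι) :
    ∑ e : ι → ℤˣ, sgn 𝕜 (e x) * sgn 𝕜 (e y) =
      if x = y then (Fintype.card (ι → ℤˣ) : 𝕜) else 0 := by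
  split_ifs with h
  · subst h
    simp [-Fintype.card_pi]
  · have : ∑ e : ι → ℤˣ, sgn 𝕜 (e x) * sgn 𝕜 (e y) =
        ∑ e : ι → ℤˣ, -(sgn 𝕜 (e x) * sgn 𝕜 (e y)) := by
      refine Fintype.sum_equiv (Equiv.mulLeft (Pi.mulSingle x (-1 : ℤˣ))) _ _ fun e => ?_
      simp [sgn, Pi.mulSingle_eq_of_ne (Ne.symm h)]
    rw [Finset.sum_neg_distrib] at this
    exact self_eq_neg.1 this

end Signs

/-! ### Restriction to block diagonals -/

section Diagonal

variable {𝕜 : Type*} [RCLike 𝕜] {κ ι : Type*} [Fintype κ] [DecidableEq κ] [Fintype ι]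

/-- Restriction of a form to the diagonals of blocks of equal variables does not increase the
bound. -/
theorem FormBound.diagonal {n : κ → ℕ} (hn : ∀ j, 1 ≤ n j) {ρ : κ → ℝ}
    {c : ((Σ j, Fin (n j)) → ι) → 𝕜} {M : ℝ} (h : FormBound (fun s => ρ s.1) c M) :
    FormBound (fun j => n j * ρ j) (fun i => c fun s => i s.1) M := by
  classical
  intro u ω hu hω
  let z : ∀ j, Fin (n j) := fun j => ⟨0, hn j⟩
  -- Each slot carries its own signs, and the first slot of a block also carries ω and the product
  -- of all signs of the block. The term at x then gets the factors ε_s(x_first) ε_s(x_s), whose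
  -- average is 1 if x is constant on every block and 0 otherwise.
  let Ω : ((Σ j, Fin (n j)) → ι → ℤˣ) → (Σ j, Fin (n j)) → ι → 𝕜 := fun ε s x =>
    (if s.2 = z s.1 then ω s.1 x * ∏ t, sgn 𝕜 (ε ⟨s.1, t⟩ x) else 1) * sgn 𝕜 (ε s x)
  have hΩ : ∀ ε s x, ‖Ω ε s x‖ ≤ 1 := by
    intro ε s x
    simp only [Ω, norm_mul, norm_sgn, mul_one]
    split_ifs <;> simp [hω]
  have hb : ∀ ε, ‖∑ x : (Σ j, Fin (n j)) → ι,
      (∏ s, Ω ε s (x s) * ((u s.1 (x s) ^ ρ s.1 : ℝ) : 𝕜)) * c x‖ ≤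
      M * ∏ j, (∑ x, u j x) ^ (n j * ρ j) := by
    intro ε
    refine (h (fun s => u s.1) (Ω ε) (fun s => hu s.1) (hΩ ε)).trans (le_of_eq ?_)
    rw [Fintype.prod_sigma]
    congr 1
    refine Finset.prod_congr rfl fun j _ => ?_
    simp only [Finset.prod_const, Finset.card_univ, Fintype.card_fin]
    rw [mul_comm, Real.rpow_mul_natCast (Finset.sum_nonneg fun x _ => hu j x)]
  have hprod : ∀ ε (x : (Σ j, Fin (n j)) → ι), ∏ s, Ω ε s (x s) =
      (∏ j, ω j (x ⟨j, z j⟩)) * ∏ s, (sgn 𝕜 (ε s (x ⟨s.1, z s.1⟩)) * sgn 𝕜 (ε s (x s))) := by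
    intro ε x
    simp only [Ω, Finset.prod_mul_distrib]
    rw [← mul_assoc]
    congr 1
    rw [Fintype.prod_sigma, Fintype.prod_sigma, ← Finset.prod_mul_distrib]
    refine Finset.prod_congr rfl fun j _ => ?_
    simp
  have horth : ∀ x : (Σ j, Fin (n j)) → ι,
      ∑ ε : (Σ j, Fin (n j)) → ι → ℤˣ,
        ∏ s, (sgn 𝕜 (ε s (x ⟨s.1, z s.1⟩)) * sgn 𝕜 (ε s (x s))) =
      if ∀ s : Σ j, Fin (n j), x ⟨s.1, z s.1⟩ = x s then
        (Fintype.card ((Σ j, Fin (n j)) → ι → ℤˣ) : 𝕜) else 0 := by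
    intro x
    rw [← Fintype.prod_sum fun (s : Σ j, Fin (n j)) (e : ι → ℤˣ) =>
      sgn 𝕜 (e (x ⟨s.1, z s.1⟩)) * sgn 𝕜 (e (x s))]
    simp_rw [sum_sgn_mul_sgn]
    split_ifs with hx
    · rw [Finset.prod_congr rfl fun s _ => if_pos (hx s), Finset.prod_const, Finset.card_univ,
        Fintype.card_fun (α := Σ j, Fin (n j))]
      push_cast
      rfl
    · push Not at hx
      obtain ⟨s, hs⟩ := hx
      exact Finset.prod_eq_zero (Finset.mem_univ s) (if_neg hs)
  have havg : ∑ ε : (Σ j, Fin (n j)) → ι → ℤˣ, ∑ x : (Σ j, Fin (n j)) → ι,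
      (∏ s, Ω ε s (x s) * ((u s.1 (x s) ^ ρ s.1 : ℝ) : 𝕜)) * c x =
      (Fintype.card ((Σ j, Fin (n j)) → ι → ℤˣ) : 𝕜) * ∑ i : κ → ι,
        (∏ j, ω j (i j) * ((u j (i j) ^ (n j * ρ j) : ℝ) : 𝕜)) * c fun s => i s.1 := by
    rw [Finset.sum_comm]
    simp_rw [Finset.prod_mul_distrib, hprod]
    have : ∀ x : (Σ j, Fin (n j)) → ι, ∑ ε : (Σ j, Fin (n j)) → ι → ℤˣ,
        (∏ j, ω j (x ⟨j, z j⟩)) * (∏ s, (sgn 𝕜 (ε s (x ⟨s.1, z s.1⟩)) * sgn 𝕜 (ε s (x s)))) *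
          (∏ s, ((u s.1 (x s) ^ ρ s.1 : ℝ) : 𝕜)) * c x =
        if ∀ s : Σ j, Fin (n j), x ⟨s.1, z s.1⟩ = x s then
          (∏ j, ω j (x ⟨j, z j⟩)) * (Fintype.card ((Σ j, Fin (n j)) → ι → ℤˣ) : 𝕜) *
          (∏ s, ((u s.1 (x s) ^ ρ s.1 : ℝ) : 𝕜)) * c x else 0 := by
      intro x
      rw [← Finset.sum_mul, ← Finset.sum_mul, ← Finset.mul_sum, horth]
      split_ifs <;> simp
    rw [Finset.sum_congr rfl fun x _ => this x, ← Finset.sum_filter, Finset.mul_sum]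
    refine Finset.sum_bij' (fun x _ j => x ⟨j, z j⟩) (fun i _ s => i s.1) (by simp) (by simp)
      ?_ (by simp) ?_
    · intro x hx
      funext s
      exact (Finset.mem_filter.1 hx).2 s
    · intro x hx
      have hx' := (Finset.mem_filter.1 hx).2
      have h1 : (fun s : Σ j, Fin (n j) => x ⟨s.1, z s.1⟩) = x := funext hx'
      have h2 : ∏ s : Σ j, Fin (n j), ((u s.1 (x s) ^ ρ s.1 : ℝ) : 𝕜) =
          ∏ j, ((u j (x ⟨j, z j⟩) ^ (n j * ρ j) : ℝ) : 𝕜) := by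
        rw [Fintype.prod_sigma]
        refine Finset.prod_congr rfl fun j _ => ?_
        simp_rw [← hx' ⟨j, _⟩]
        rw [Finset.prod_const, Finset.card_univ, Fintype.card_fin, mul_comm,
          Real.rpow_mul_natCast (hu _ _)]
        push_cast
        rfl
      rw [h1, h2]
      ring
  have hle := norm_sum_le_of_le Finset.univ fun ε _ => hb ε
  rw [havg, norm_mul, RCLike.norm_natCast, Finset.sum_const, nsmul_eq_mul] at hle
  exact le_of_mul_le_mul_left hle (by exact_mod_cast Fintype.card_pos)

end Diagonal

/-! ### Khinchine's inequality and the (ℓ₁, ℓ₂) estimate -/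

section Khinchine

variable {𝕜 : Type*} [RCLike 𝕜] {ι : Type*} [Fintype ι] [DecidableEq ι]
  {E : Type*} [NormedAddCommGroup E] [InnerProductSpace 𝕜 E]

theorem norm_add_pow_four_add_norm_sub_pow_four_le (𝕜 : Type*) [RCLike 𝕜] {E : Type*}
    [NormedAddCommGroup E] [InnerProductSpace 𝕜 E] (a b : E) :
    ‖a + b‖ ^ 4 + ‖a - b‖ ^ 4 ≤ 2 * (‖a‖ ^ 4 + 6 * (‖a‖ ^ 2 * ‖b‖ ^ 2) + ‖b‖ ^ 4) := by
  have h1 := @norm_add_sq 𝕜 E _ _ _ a b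
  have h2 := @norm_sub_sq 𝕜 E _ _ _ a b
  have h3 : (RCLike.re (inner 𝕜 a b)) ^ 2 ≤ (‖a‖ * ‖b‖) ^ 2 :=
    sq_le_sq.2 (((RCLike.abs_re_le_norm _).trans (norm_inner_le_norm a b)).trans (le_abs_self _))
  have e1 : ‖a + b‖ ^ 4 = (‖a + b‖ ^ 2) ^ 2 := by ring
  have e2 : ‖a - b‖ ^ 4 = (‖a - b‖ ^ 2) ^ 2 := by ring
  rw [e1, e2, h1, h2]
  nlinarith [h3]

/-- A Rademacher sum over `s`. -/
noncomputable def rademacher (𝕜 : Type*) [RCLike 𝕜] {ι E : Type*} [NormedAddCommGroup E]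
    [InnerProductSpace 𝕜 E] (c : ι → E) (s : Finset ι) (ε : ι → ℤˣ) : E :=
  ∑ x ∈ s, sgn 𝕜 (ε x) • c x

/-- Flipping the sign at x permutes the sign patterns and leaves the sum over s unchanged. This is
the induction step for both moments. -/
theorem two_mul_sum_rademacher_insert (c : ι → E) {s : Finset ι} {x : ι} (hx : x ∉ s)
    (G : E → ℝ) :
    2 * ∑ ε : ι → ℤˣ, G (rademacher 𝕜 c (insert x s) ε) =
      ∑ ε : ι → ℤˣ, (G (rademacher 𝕜 c s ε + sgn 𝕜 (ε x) • c x) +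
        G (rademacher 𝕜 c s ε - sgn 𝕜 (ε x) • c x)) := by
  have h : ∀ ε, rademacher 𝕜 c (insert x s) ε = rademacher 𝕜 c s ε + sgn 𝕜 (ε x) • c x := by
    intro ε
    rw [rademacher, Finset.sum_insert hx, add_comm, rademacher]
  rw [Finset.sum_add_distrib, two_mul]
  simp_rw [h]
  congr 1
  refine Fintype.sum_equiv (Equiv.mulLeft (Pi.mulSingle x (-1 : ℤˣ))) _ _ fun ε => ?_
  have : rademacher 𝕜 c s (Pi.mulSingle x (-1 : ℤˣ) * ε) = rademacher 𝕜 c s ε := by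
    refine Finset.sum_congr rfl fun y hy => ?_
    have : y ≠ x := fun h => hx (h ▸ hy)
    simp [Pi.mulSingle_eq_of_ne this]
  simp [this, sgn]

theorem sum_norm_rademacher_sq (c : ι → E) (s : Finset ι) :
    ∑ ε : ι → ℤˣ, ‖rademacher 𝕜 c s ε‖ ^ 2 =
      Fintype.card (ι → ℤˣ) * ∑ x ∈ s, ‖c x‖ ^ 2 := by
  induction s using Finset.induction_on with
  | empty => simp [rademacher]
  | insert x s hx ih =>
    have := two_mul_sum_rademacher_insert (𝕜 := 𝕜) c hx (fun v => ‖v‖ ^ 2)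
    have h2 : ∀ ε : ι → ℤˣ, ‖rademacher 𝕜 c s ε + sgn 𝕜 (ε x) • c x‖ ^ 2 +
        ‖rademacher 𝕜 c s ε - sgn 𝕜 (ε x) • c x‖ ^ 2 =
        2 * (‖rademacher 𝕜 c s ε‖ ^ 2 + ‖c x‖ ^ 2) := by
      intro ε
      have := parallelogram_law_with_norm 𝕜 (rademacher 𝕜 c s ε) (sgn 𝕜 (ε x) • c x)
      rw [norm_smul, norm_sgn, one_mul] at this
      linarith
    rw [Finset.sum_congr rfl fun ε _ => h2 ε, ← Finset.mul_sum, Finset.sum_add_distrib, ih,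
      Finset.sum_const, Finset.card_univ, nsmul_eq_mul] at this
    rw [Finset.sum_insert hx]
    linarith

theorem sum_norm_rademacher_pow_four_le (c : ι → E) (s : Finset ι) :
    ∑ ε : ι → ℤˣ, ‖rademacher 𝕜 c s ε‖ ^ 4 ≤
      3 * Fintype.card (ι → ℤˣ) * (∑ x ∈ s, ‖c x‖ ^ 2) ^ 2 := by
  induction s using Finset.induction_on with
  | empty => simp [rademacher]
  | insert x s hx ih =>
    have := two_mul_sum_rademacher_insert (𝕜 := 𝕜) c hx (fun v => ‖v‖ ^ 4)
    have h2 : ∀ ε : ι → ℤˣ, ‖rademacher 𝕜 c s ε + sgn 𝕜 (ε x) • c x‖ ^ 4 +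
        ‖rademacher 𝕜 c s ε - sgn 𝕜 (ε x) • c x‖ ^ 4 ≤
        2 * (‖rademacher 𝕜 c s ε‖ ^ 4 + ‖rademacher 𝕜 c s ε‖ ^ 2 * (6 * ‖c x‖ ^ 2) +
          ‖c x‖ ^ 4) := by
      intro ε
      have := norm_add_pow_four_add_norm_sub_pow_four_le 𝕜 (rademacher 𝕜 c s ε)
        (sgn 𝕜 (ε x) • c x)
      rw [norm_smul, norm_sgn, one_mul] at this
      linarith
    have h3 := this.le.trans (Finset.sum_le_sum fun ε _ => h2 ε)
    rw [← Finset.mul_sum, Finset.sum_add_distrib, Finset.sum_add_distrib, ← Finset.sum_mul,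
      sum_norm_rademacher_sq, Finset.sum_const, Finset.card_univ, nsmul_eq_mul] at h3
    rw [Finset.sum_insert hx]
    have h4 : (0 : ℝ) ≤ Fintype.card (ι → ℤˣ) * (‖c x‖ ^ 2) ^ 2 := by positivity
    nlinarith [h3, ih, h4]

/-- **Khinchine's inequality** between the first and the second moment. -/
theorem khinchine (c : ι → E) :
    Fintype.card (ι → ℤˣ) * √(∑ x, ‖c x‖ ^ 2) ≤
      √3 * ∑ ε : ι → ℤˣ, ‖∑ x, sgn 𝕜 (ε x) • c x‖ := by
  set B := ∑ x, ‖c x‖ ^ 2 with hB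
  set G : ℝ := (Fintype.card (ι → ℤˣ) : ℝ)
  set A := ∑ ε : ι → ℤˣ, ‖∑ x, sgn 𝕜 (ε x) • c x‖ with hA
  have hA0 : 0 ≤ A := Finset.sum_nonneg fun _ _ => norm_nonneg _
  have hB0 : 0 ≤ B := Finset.sum_nonneg fun _ _ => by positivity
  have h2 := sum_norm_rademacher_sq (𝕜 := 𝕜) c Finset.univ
  have h4 := sum_norm_rademacher_pow_four_le (𝕜 := 𝕜) c Finset.univ
  rw [← hB] at h2 h4
  rcases hB0.eq_or_lt with h0 | h0
  · rw [← h0]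
    simpa using by positivity
  set s := √3 * √B with hs
  have hs2 : s ^ 2 = 3 * B := by
    rw [hs, mul_pow, Real.sq_sqrt (by norm_num), Real.sq_sqrt hB0]
  have hs0 : 0 ≤ s := by positivity
  -- The difference of the two sides is t(t-s)²(t+2s). Summed over the signs, it bounds the first
  -- moment below by the second and fourth; the choice s² = 3B produces the constant √3.
  have hpt : ∀ t : ℝ, 0 ≤ t → 3 * s ^ 2 * t ^ 2 ≤ 2 * s ^ 3 * t + t ^ 4 := by
    intro t ht
    have : 0 ≤ t * ((t - s) ^ 2 * (t + 2 * s)) := by positivity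
    nlinarith
  have hsum := Finset.sum_le_sum (s := (Finset.univ : Finset (ι → ℤˣ)))
    fun ε _ => hpt ‖rademacher 𝕜 c Finset.univ ε‖ (norm_nonneg _)
  rw [← Finset.mul_sum, Finset.sum_add_distrib, ← Finset.mul_sum, h2] at hsum
  have hA' : ∑ ε : ι → ℤˣ, ‖rademacher 𝕜 c Finset.univ ε‖ = A := rfl
  rw [hA', pow_succ s 2, hs2] at hsum
  have h5 : 3 * (3 * B) * (G * B) ≤ 2 * (3 * B * s) * A + 3 * G * B ^ 2 := hsum.trans (by gcongr)
  have h6 : B * (G * B) ≤ B * (s * A) := by nlinarith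
  have h7 := le_of_mul_le_mul_left h6 h0
  have h8 : √B * (G * √B) ≤ √B * (√3 * A) := by
    calc √B * (G * √B) = G * (√B * √B) := by ring
      _ = G * B := by rw [Real.mul_self_sqrt hB0]
      _ ≤ s * A := h7
      _ = √B * (√3 * A) := by rw [hs]; ring
  exact le_of_mul_le_mul_left h8 (Real.sqrt_pos.2 h0)

theorem sum_fin_succ_pi {α M : Type*} [Fintype α] [AddCommMonoid M] {k : ℕ}
    (F : (Fin (k + 1) → α) → M) :
    ∑ i, F i = ∑ x, ∑ v : Fin k → α, F (Fin.cons x v) := by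
  rw [← Fintype.sum_prod_type']
  exact (Fintype.sum_equiv (Fin.consEquiv fun _ => α) _ _ fun _ => rfl).symm

/-- Khinchine's inequality for decoupled Rademacher chaos. -/
theorem khinchine_multi : ∀ {k : ℕ} (c : (Fin k → ι) → 𝕜),
    Fintype.card (Fin k → ι → ℤˣ) * √(∑ i, ‖c i‖ ^ 2) ≤
      √3 ^ k * ∑ ε : Fin k → ι → ℤˣ, ‖∑ i : Fin k → ι, (∏ j, sgn 𝕜 (ε j (i j))) * c i‖
  | 0, c => by simp [Real.sqrt_sq]
  | k + 1, c => by
    -- The remaining k variables form a Hilbert space, so the vector-valued inequality handles the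
    -- first variable and induction the others.
    let C : ι → EuclideanSpace 𝕜 (Fin k → ι) := fun x => WithLp.toLp 2 fun v => c (Fin.cons x v)
    have h1 := khinchine (𝕜 := 𝕜) C
    have hC : ∑ x, ‖C x‖ ^ 2 = ∑ i, ‖c i‖ ^ 2 := by
      rw [sum_fin_succ_pi]
      refine Finset.sum_congr rfl fun x _ => ?_
      rw [EuclideanSpace.norm_sq_eq]
    have h2 : ∀ e : ι → ℤˣ, Fintype.card (Fin k → ι → ℤˣ) * ‖∑ x, sgn 𝕜 (e x) • C x‖ ≤
        √3 ^ k * ∑ ε : Fin k → ι → ℤˣ, ‖∑ v : Fin k → ι, (∏ j, sgn 𝕜 (ε j (v j))) *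
          ∑ x, sgn 𝕜 (e x) * c (Fin.cons x v)‖ := by
      intro e
      have := khinchine_multi fun v : Fin k → ι => ∑ x, sgn 𝕜 (e x) * c (Fin.cons x v)
      convert this using 2
      rw [EuclideanSpace.norm_eq]
      simp [C]
    rw [hC] at h1
    have hcard : (Fintype.card (Fin (k + 1) → ι → ℤˣ) : ℝ) =
        Fintype.card (Fin k → ι → ℤˣ) * Fintype.card (ι → ℤˣ) := by
      rw [Fintype.card_fun (α := Fin (k + 1)), Fintype.card_fun (α := Fin k)]
      simp only [Fintype.card_fin]
      push_cast
      ring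
    calc (Fintype.card (Fin (k + 1) → ι → ℤˣ) : ℝ) * √(∑ i, ‖c i‖ ^ 2)
        = Fintype.card (Fin k → ι → ℤˣ) * (Fintype.card (ι → ℤˣ) * √(∑ i, ‖c i‖ ^ 2)) := by
          rw [hcard]; ring
      _ ≤ Fintype.card (Fin k → ι → ℤˣ) *
          (√3 * ∑ e : ι → ℤˣ, ‖∑ x, sgn 𝕜 (e x) • C x‖) := by gcongr
      _ = √3 * ∑ e : ι → ℤˣ,
          Fintype.card (Fin k → ι → ℤˣ) * ‖∑ x, sgn 𝕜 (e x) • C x‖ := by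
          rw [← Finset.mul_sum]; ring
      _ ≤ √3 * ∑ e : ι → ℤˣ, √3 ^ k * ∑ ε : Fin k → ι → ℤˣ,
          ‖∑ v : Fin k → ι, (∏ j, sgn 𝕜 (ε j (v j))) *
            ∑ x, sgn 𝕜 (e x) * c (Fin.cons x v)‖ := by
          exact mul_le_mul_of_nonneg_left (Finset.sum_le_sum fun e _ => h2 e) (Real.sqrt_nonneg _)
      _ = _ := by
          rw [← Finset.mul_sum, ← mul_assoc, ← pow_succ', sum_fin_succ_pi]
          congr 1
          refine Finset.sum_congr rfl fun e _ => Finset.sum_congr rfl fun ε _ => ?_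
          congr 1
          rw [sum_fin_succ_pi, Finset.sum_comm]
          refine Finset.sum_congr rfl fun v _ => ?_
          rw [Finset.mul_sum]
          refine Finset.sum_congr rfl fun x _ => ?_
          rw [Fin.prod_univ_succ]
          simp only [Fin.cons_zero, Fin.cons_succ]
          ring

/-- The mixed `(ℓ₁, ℓ₂)` inequality for the coefficients of a bounded form, with weights. -/
theorem FormBound.sum_sqrt_le {k : ℕ} {ρ : Fin k → ℝ} {c : (Fin k → ι) → 𝕜} {M : ℝ}
    (h : FormBound ρ c M) (j : Fin k) (u : Fin k → ι → ℝ) (hu : ∀ l x, 0 ≤ u l x) :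
    ∑ x, √(∑ i with i j = x, ‖c i‖ ^ 2 * ∏ l, u l (i l) ^ (2 * ρ l)) ≤
      √3 ^ k * M * ∏ l, (∑ x, u l x) ^ ρ l := by
  let U : (Fin k → ι) → ℝ := fun i => ∏ l, u l (i l) ^ ρ l
  have hU : ∀ i, 0 ≤ U i := fun i => Finset.prod_nonneg fun l _ => Real.rpow_nonneg (hu _ _) _
  let d : ι → (Fin k → ι) → 𝕜 := fun x i => if i j = x then (U i : 𝕜) * c i else 0
  let Z : (Fin k → ι → ℤˣ) → ι → 𝕜 := fun ε x =>
    ∑ i : Fin k → ι, (∏ l, sgn 𝕜 (ε l (i l))) * d x i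
  have hd : ∀ x, ∑ i, ‖d x i‖ ^ 2 =
      ∑ i with i j = x, ‖c i‖ ^ 2 * ∏ l, u l (i l) ^ (2 * ρ l) := by
    intro x
    rw [Finset.sum_filter]
    refine Finset.sum_congr rfl fun i _ => ?_
    simp only [d]
    split_ifs
    · rw [norm_mul, RCLike.norm_ofReal, abs_of_nonneg (hU i), mul_pow, mul_comm,
        ← Finset.prod_pow]
      congr 1
      refine Finset.prod_congr rfl fun l _ => ?_
      rw [mul_comm 2, ← Real.rpow_mul_natCast (hu _ _)]
      norm_num
    · simp
  have hZ : ∀ ε, ∑ x, ‖Z ε x‖ ≤ M * ∏ l, (∑ x, u l x) ^ ρ l := by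
    intro ε
    -- These phases, placed in variable j, turn ∑|Z ε x| into a single value of the form.
    let η : ι → 𝕜 := fun x => (starRingEnd 𝕜) (Z ε x) / (‖Z ε x‖ : 𝕜)
    have hη : ∀ x, ‖η x‖ ≤ 1 := fun x => by
      simp only [η, norm_div, RCLike.norm_conj, RCLike.norm_ofReal, abs_norm]
      exact div_self_le_one _
    have hη' : ∀ x, η x * Z ε x = (‖Z ε x‖ : 𝕜) := by
      intro x
      by_cases h0 : Z ε x = 0
      · simp [h0]
      · have : (‖Z ε x‖ : 𝕜) ≠ 0 := RCLike.ofReal_ne_zero.2 (norm_ne_zero_iff.2 h0)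
        simp only [η]
        rw [div_mul_eq_mul_div, RCLike.conj_mul, sq, mul_div_cancel_right₀ _ this]
    have := h u (fun l x => (if l = j then η x else 1) * sgn 𝕜 (ε l x)) hu (fun l x => by
      split_ifs <;> simp [hη])
    refine le_trans (le_of_eq ?_) this
    have e1 : ((∑ x, ‖Z ε x‖ : ℝ) : 𝕜) = ∑ i : Fin k → ι,
        (∏ l, (if l = j then η (i l) else 1) * sgn 𝕜 (ε l (i l)) *
          ((u l (i l) ^ ρ l : ℝ) : 𝕜)) * c i := by
      push_cast
      simp_rw [← hη', Z, Finset.mul_sum]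
      rw [Finset.sum_comm]
      refine Finset.sum_congr rfl fun i _ => ?_
      rw [Finset.sum_eq_single (i j)]
      · simp only [d, if_true, U, Finset.prod_mul_distrib, Finset.prod_ite_eq', Finset.mem_univ]
        push_cast
        ring
      · intro x _ hx
        simp [d, hx.symm]
      · simp
    rw [← e1, RCLike.norm_ofReal, abs_of_nonneg (Finset.sum_nonneg fun _ _ => norm_nonneg _)]
  have hG : (0 : ℝ) < Fintype.card (Fin k → ι → ℤˣ) := by exact_mod_cast Fintype.card_pos
  refine le_of_mul_le_mul_left ?_ hG
  calc _ = ∑ x, (Fintype.card (Fin k → ι → ℤˣ) : ℝ) * √(∑ i, ‖d x i‖ ^ 2) := by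
        rw [Finset.mul_sum]; simp_rw [hd]
    _ ≤ ∑ x, √3 ^ k * ∑ ε, ‖Z ε x‖ := Finset.sum_le_sum fun x _ => khinchine_multi (d x)
    _ = √3 ^ k * ∑ ε, ∑ x, ‖Z ε x‖ := by rw [← Finset.mul_sum, Finset.sum_comm]
    _ ≤ √3 ^ k * ∑ ε : Fin k → ι → ℤˣ, M * ∏ l, (∑ x, u l x) ^ ρ l := by
        gcongr with ε; exact hZ ε
    _ = _ := by
        rw [Finset.sum_const, Finset.card_univ, nsmul_eq_mul]; ring

end Khinchine

/-! ### Diagonal multipliers -/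

section Twist

variable {𝕜 : Type*} [RCLike 𝕜] {κ ι : Type*} [Fintype κ] [DecidableEq κ] [Fintype ι]

theorem rpow_sum_rpow_mul_rpow_le {u v : ι → ℝ} (hu : ∀ x, 0 ≤ u x) (hv : ∀ x, 0 ≤ v x)
    {σ ρ : ℝ} (hσ : 0 ≤ σ) (hσρ : σ ≤ ρ) :
    (∑ x, u x ^ (σ / ρ) * v x ^ ((ρ - σ) / ρ)) ^ ρ ≤
      (∑ x, u x) ^ σ * (∑ x, v x) ^ (ρ - σ) := by
  rcases (hσ.trans hσρ).eq_or_lt with h | h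
  · have : σ = 0 := le_antisymm (h ▸ hσρ) hσ
    simp [← h, this]
  have hsu : 0 ≤ ∑ x, u x := Finset.sum_nonneg fun x _ => hu x
  have hsv : 0 ≤ ∑ x, v x := Finset.sum_nonneg fun x _ => hv x
  have := sum_mul_prod_rpow_le Finset.univ u (fun _ : Unit => v) (σ / ρ) (fun _ => (ρ - σ) / ρ)
    hu (fun _ => hv) (by positivity) (fun _ => div_nonneg (by linarith) h.le)
    (by simp; field_simp; ring)
  simp only [Fintype.univ_punit, Finset.prod_singleton] at this
  refine (Real.rpow_le_rpow (Finset.sum_nonneg fun x _ => ?_) this h.le).trans (le_of_eq ?_)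
  · exact mul_nonneg (Real.rpow_nonneg (hu x) _) (Real.rpow_nonneg (hv x) _)
  · rw [Real.mul_rpow (by positivity) (by positivity), ← Real.rpow_mul hsu, ← Real.rpow_mul hsv,
      div_mul_cancel₀ _ h.ne', div_mul_cancel₀ _ h.ne']

/-- Multiplying the coefficients of a bounded form by diagonal weights increases the exponents of
the spaces on which it is bounded. -/
theorem FormBound.twist {ρ σ : κ → ℝ} {c : (κ → ι) → 𝕜} {M : ℝ} (h : FormBound ρ c M)
    (hM : 0 ≤ M) (hσ : ∀ j, 0 ≤ σ j) (hσρ : ∀ j, σ j ≤ ρ j) {v : κ → ι → ℝ}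
    (hv : ∀ j x, 0 ≤ v j x) :
    FormBound σ (fun i => ((∏ j, v j (i j) ^ (ρ j - σ j) : ℝ) : 𝕜) * c i)
      (M * ∏ j, (∑ x, v j x) ^ (ρ j - σ j)) := by
  intro u ω hu hω
  -- Chosen so that w^ρ = u^σ v^{ρ-σ}: the multiplier is absorbed into the test vector, and Hölder
  -- bounds ∑w. If ρ_j = 0 then σ_j = 0 and every power is 1.
  let w : κ → ι → ℝ := fun j x => u j x ^ (σ j / ρ j) * v j x ^ ((ρ j - σ j) / ρ j)
  have hw0 : ∀ j x, 0 ≤ w j x := fun j x =>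
    mul_nonneg (Real.rpow_nonneg (hu j x) _) (Real.rpow_nonneg (hv j x) _)
  have hw : ∀ j x, w j x ^ ρ j = u j x ^ σ j * v j x ^ (ρ j - σ j) := by
    intro j x
    rcases ((hσ j).trans (hσρ j)).eq_or_lt with h | h
    · have : σ j = 0 := le_antisymm (h ▸ hσρ j) (hσ j)
      simp [← h, this]
    · rw [Real.mul_rpow (Real.rpow_nonneg (hu j x) _) (Real.rpow_nonneg (hv j x) _),
        ← Real.rpow_mul (hu j x), ← Real.rpow_mul (hv j x), div_mul_cancel₀ _ h.ne',
        div_mul_cancel₀ _ h.ne']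
  have := h w ω hw0 hω
  refine le_trans (le_of_eq ?_) (this.trans ?_)
  · congr 1
    refine Finset.sum_congr rfl fun i _ => ?_
    simp_rw [hw]
    push_cast
    rw [← mul_assoc, ← Finset.prod_mul_distrib]
    congr 1
    exact Finset.prod_congr rfl fun j _ => by ring
  · rw [mul_assoc, ← Finset.prod_mul_distrib]
    refine mul_le_mul_of_nonneg_left (Finset.prod_le_prod
      (fun j _ => Real.rpow_nonneg (Finset.sum_nonneg fun x _ => hw0 j x) _) fun j _ => ?_) hM
    rw [mul_comm]
    exact rpow_sum_rpow_mul_rpow_le (hu j) (hv j) (hσ j) (hσρ j)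

end Twist

/-! ### Summability of the coefficients of a bounded form -/

section Summability

variable {𝕜 : Type*} [RCLike 𝕜] {ι : Type*} [Fintype ι] [DecidableEq ι] {k : ℕ}

/-- The sum of the `|c_i|²` over the multi-indices with `i_j = x`. -/
def sliceSq (c : (Fin k → ι) → 𝕜) (j : Fin k) (x : ι) : ℝ :=
  ∑ i with i j = x, ‖c i‖ ^ 2

theorem sliceSq_nonneg (c : (Fin k → ι) → 𝕜) (j : Fin k) (x : ι) : 0 ≤ sliceSq c j x :=
  Finset.sum_nonneg fun _ _ => by positivity

theorem sq_le_sliceSq (c : (Fin k → ι) → 𝕜) (j : Fin k) (i : Fin k → ι) :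
    ‖c i‖ ^ 2 ≤ sliceSq c j (i j) :=
  Finset.single_le_sum (f := fun i => ‖c i‖ ^ 2) (fun _ _ => by positivity) (by simp)

theorem sum_sliceSq (c : (Fin k → ι) → 𝕜) (j : Fin k) :
    ∑ x, sliceSq c j x = ∑ i, ‖c i‖ ^ 2 :=
  Finset.sum_fiberwise _ _ _

theorem mul_rpow_sub_one {a b : ℝ} (ha : 0 ≤ a) (hb : b ≠ 0) : a * a ^ (b - 1) = a ^ b := by
  rcases ha.eq_or_lt with rfl | ha
  · rw [zero_mul, Real.zero_rpow hb]
  · rw [Real.rpow_sub_one ha.ne']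
    field_simp

/-- Hölder with weights 1-2R and 2ρ_l. With S_l the slice sums, the powers of S_l inside cancel
because λ - 2 = -λ(1-2R). -/
theorem sliceSq_rpow_le {ρ : Fin k → ℝ} (hρ : ∀ j, 0 ≤ ρ j) (hR : ∑ j, ρ j < 1 / 2)
    (c : (Fin k → ι) → 𝕜) (j : Fin k) (x : ι) {lam : ℝ} (hlam : lam * (1 - ∑ j, ρ j) = 1) :
    sliceSq c j x ≤
      (∑ i with i j = x, ‖c i‖ ^ 2 * ∏ l, (sliceSq c l (i l) ^ (lam / 2)) ^ (2 * ρ l)) ^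
          (1 - 2 * ∑ j, ρ j) *
        ∏ l, (∑ i with i j = x, ‖c i‖ ^ 2 * sliceSq c l (i l) ^ (lam / 2 - 1)) ^ (2 * ρ l) := by
  set R := ∑ j, ρ j with hRdef
  have hQ := sliceSq_nonneg c
  refine le_trans (Finset.sum_le_sum fun i _ => le_of_eq ?_)
    (sum_mul_prod_rpow_le _
      (fun i : Fin k → ι => ‖c i‖ ^ 2 * ∏ l, (sliceSq c l (i l) ^ (lam / 2)) ^ (2 * ρ l))
      (fun l i => ‖c i‖ ^ 2 * sliceSq c l (i l) ^ (lam / 2 - 1)) (1 - 2 * R) (fun l => 2 * ρ l)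
      (fun i => mul_nonneg (by positivity) (Finset.prod_nonneg fun l _ =>
        Real.rpow_nonneg (Real.rpow_nonneg (hQ _ _) _) _))
      (fun l i => mul_nonneg (by positivity) (Real.rpow_nonneg (hQ _ _) _)) (by linarith)
      (fun l => by linarith [hρ l]) (by rw [← Finset.mul_sum]; ring))
  rcases (sq_nonneg ‖c i‖).eq_or_lt with h0 | h0
  · rw [← h0, zero_mul, Real.zero_rpow (by linarith), zero_mul]
  have hpos : ∀ l, 0 < sliceSq c l (i l) := fun l => h0.trans_le (sq_le_sliceSq c l i)
  have e1 : ∀ l, (‖c i‖ ^ 2 * sliceSq c l (i l) ^ (lam / 2 - 1)) ^ (2 * ρ l) =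
      (‖c i‖ ^ 2) ^ (2 * ρ l) * sliceSq c l (i l) ^ (-(lam * ρ l * (1 - 2 * R))) := by
    intro l
    rw [Real.mul_rpow h0.le (Real.rpow_nonneg (hQ _ _) _), ← Real.rpow_mul (hQ _ _)]
    congr 2
    linear_combination (2 * ρ l) * hlam
  have e2 : (∏ l, (sliceSq c l (i l) ^ (lam / 2)) ^ (2 * ρ l)) ^ (1 - 2 * R) =
      ∏ l, sliceSq c l (i l) ^ (lam * ρ l * (1 - 2 * R)) := by
    rw [← Real.finsetProd_rpow _ _ fun l _ => Real.rpow_nonneg (Real.rpow_nonneg (hQ _ _) _) _]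
    refine Finset.prod_congr rfl fun l _ => ?_
    rw [← Real.rpow_mul (hQ _ _), ← Real.rpow_mul (hQ _ _)]
    congr 1
    ring
  have e3 : ∏ l, (‖c i‖ ^ 2) ^ (2 * ρ l) = (‖c i‖ ^ 2) ^ (2 * R) := by
    rw [← Real.rpow_sum_of_pos h0, ← Finset.mul_sum]
  have e4 : (∏ l, sliceSq c l (i l) ^ (lam * ρ l * (1 - 2 * R))) *
      ∏ l, sliceSq c l (i l) ^ (-(lam * ρ l * (1 - 2 * R))) = 1 := by
    rw [← Finset.prod_mul_distrib]
    refine Finset.prod_eq_one fun l _ => ?_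
    rw [← Real.rpow_add (hpos l), add_neg_cancel, Real.rpow_zero]
  rw [Real.mul_rpow h0.le (Finset.prod_nonneg fun l _ =>
    Real.rpow_nonneg (Real.rpow_nonneg (hQ _ _) _) _), e2]
  simp_rw [e1]
  rw [Finset.prod_mul_distrib, e3]
  calc ‖c i‖ ^ 2 = (‖c i‖ ^ 2) ^ (1 - 2 * R) * (‖c i‖ ^ 2) ^ (2 * R) * 1 := by
        rw [← Real.rpow_add h0, sub_add_cancel, Real.rpow_one, mul_one]
    _ = (‖c i‖ ^ 2) ^ (1 - 2 * R) * (‖c i‖ ^ 2) ^ (2 * R) *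
        ((∏ l, sliceSq c l (i l) ^ (lam * ρ l * (1 - 2 * R))) *
          ∏ l, sliceSq c l (i l) ^ (-(lam * ρ l * (1 - 2 * R)))) := by rw [e4]
    _ = _ := by ring

/-- The slice estimate raised to the power λ/2 is summed over x by Hölder, whose weights λ(1-2R) and
λρ_l add up to λ(1-R) = 1. The first factor is controlled by the (ℓ₁, ℓ₂) estimate with weights
S_l^{λ/2}; the others sum to ∑ S_l^{λ/2} again. -/
theorem FormBound.sum_sliceSq_le_aux {ρ : Fin k → ℝ} (hρ : ∀ j, 0 ≤ ρ j)
    (hR : ∑ j, ρ j < 1 / 2) {c : (Fin k → ι) → 𝕜} {M : ℝ} (h : FormBound ρ c M)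
    {lam : ℝ} (hlam : lam * (1 - ∑ j, ρ j) = 1) (j : Fin k) :
    (∑ x, sliceSq c j x ^ (lam / 2)) ^ (1 - ∑ j, ρ j) ≤
      (√3 ^ k * M * ∏ l, (∑ x, sliceSq c l x ^ (lam / 2)) ^ ρ l) ^ (1 - 2 * ∑ j, ρ j) *
        ∏ l, (∑ x, sliceSq c l x ^ (lam / 2)) ^ ρ l := by
  set R := ∑ j, ρ j with hRdef
  have hR0 : 0 ≤ R := Finset.sum_nonneg fun l _ => hρ l
  have hlam0 : 0 < lam := pos_of_mul_pos_left (hlam ▸ one_pos) (by linarith)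
  have hQ := sliceSq_nonneg c
  have hP := h.sum_sqrt_le j (fun l x => sliceSq c l x ^ (lam / 2))
    (fun l x => Real.rpow_nonneg (hQ l x) _)
  set P : ι → ℝ := fun x =>
    ∑ i with i j = x, ‖c i‖ ^ 2 * ∏ l, (sliceSq c l (i l) ^ (lam / 2)) ^ (2 * ρ l) with hPdef
  set V : Fin k → ι → ℝ := fun l x =>
    ∑ i with i j = x, ‖c i‖ ^ 2 * sliceSq c l (i l) ^ (lam / 2 - 1) with hVdef
  have hP0 : ∀ x, 0 ≤ P x := fun x => Finset.sum_nonneg fun i _ => mul_nonneg (by positivity)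
    (Finset.prod_nonneg fun l _ => Real.rpow_nonneg (Real.rpow_nonneg (hQ _ _) _) _)
  have hV0 : ∀ l x, 0 ≤ V l x := fun l x => Finset.sum_nonneg fun i _ =>
    mul_nonneg (by positivity) (Real.rpow_nonneg (hQ _ _) _)
  have hVsum : ∀ l, ∑ x, V l x = ∑ x, sliceSq c l x ^ (lam / 2) := by
    intro l
    rw [Finset.sum_fiberwise, ← Finset.sum_fiberwise _ fun i : Fin k → ι => i l]
    refine Finset.sum_congr rfl fun x _ => ?_
    rw [← mul_rpow_sub_one (hQ l x) (by positivity)]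
    conv_rhs => rw [sliceSq, Finset.sum_mul]
    refine Finset.sum_congr rfl fun i hi => ?_
    rw [(Finset.mem_filter.1 hi).2, sliceSq]
  have hpt : ∀ x, sliceSq c j x ^ (lam / 2) ≤
      √(P x) ^ ((1 - 2 * R) * lam) * ∏ l, V l x ^ (ρ l * lam) := by
    intro x
    refine (Real.rpow_le_rpow (hQ _ _) (sliceSq_rpow_le hρ hR c j x hlam)
      (by positivity)).trans (le_of_eq ?_)
    rw [Real.mul_rpow (Real.rpow_nonneg (hP0 x) _)
      (Finset.prod_nonneg fun l _ => Real.rpow_nonneg (hV0 l x) _), ← Real.rpow_mul (hP0 x),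
      ← Real.finsetProd_rpow _ _ fun l _ => Real.rpow_nonneg (hV0 l x) _]
    congr 1
    · rw [Real.sqrt_eq_rpow, ← Real.rpow_mul (hP0 x)]
      congr 1
      ring
    · refine Finset.prod_congr rfl fun l _ => ?_
      rw [← Real.rpow_mul (hV0 l x)]
      congr 1
      ring
  have hH := (Finset.sum_le_sum fun x _ => hpt x).trans
    (sum_mul_prod_rpow_le Finset.univ (fun x => √(P x)) V ((1 - 2 * R) * lam)
      (fun l => ρ l * lam) (fun x => Real.sqrt_nonneg _) hV0
      (mul_nonneg (by linarith) hlam0.le) (fun l => mul_nonneg (hρ l) hlam0.le) (by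
        rw [← Finset.sum_mul]; linear_combination hlam))
  simp_rw [hVsum] at hH
  have hW0 : ∀ l, 0 ≤ ∑ x, sliceSq c l x ^ (lam / 2) := fun l =>
    Finset.sum_nonneg fun x _ => Real.rpow_nonneg (hQ l x) _
  have hS0 : 0 ≤ ∑ x, √(P x) := Finset.sum_nonneg fun x _ => Real.sqrt_nonneg _
  refine (Real.rpow_le_rpow (hW0 j) hH (by linarith)).trans ?_
  rw [Real.mul_rpow (Real.rpow_nonneg hS0 _) (Finset.prod_nonneg fun l _ =>
    Real.rpow_nonneg (hW0 l) _), ← Real.rpow_mul hS0,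
    ← Real.finsetProd_rpow _ _ fun l _ => Real.rpow_nonneg (hW0 l) _]
  have e1 : (1 - 2 * R) * lam * (1 - R) = 1 - 2 * R := by rw [mul_assoc, hlam, mul_one]
  have e2 : ∀ l, ((∑ x, sliceSq c l x ^ (lam / 2)) ^ (ρ l * lam)) ^ (1 - R) =
      (∑ x, sliceSq c l x ^ (lam / 2)) ^ ρ l := by
    intro l
    rw [← Real.rpow_mul (hW0 l), mul_assoc, hlam, mul_one]
  simp_rw [e2]
  rw [e1]
  exact mul_le_mul_of_nonneg_right (Real.rpow_le_rpow hS0 hP (by linarith))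
    (Finset.prod_nonneg fun l _ => Real.rpow_nonneg (hW0 l) _)

/-- Let W be the largest of the k sums. The auxiliary bound becomes W^{1-R} ≤ C^{1-2R}
W^{R(1-2R)+R}, and dividing leaves W^{(1-R)(1-2R)} ≤ C^{1-2R}. Taking the root needs R < 1/2. -/
theorem FormBound.sum_sliceSq_le_of_lt {ρ : Fin k → ℝ} (hρ : ∀ j, 0 ≤ ρ j)
    (hR : ∑ j, ρ j < 1 / 2) {c : (Fin k → ι) → 𝕜} {M : ℝ} (h : FormBound ρ c M) (hM : 0 ≤ M)
    {lam : ℝ} (hlam : lam * (1 - ∑ j, ρ j) = 1) (j : Fin k) :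
    (∑ x, sliceSq c j x ^ (lam / 2)) ^ (1 - ∑ j, ρ j) ≤ √3 ^ k * M := by
  have haux := h.sum_sliceSq_le_aux hρ hR hlam
  set R := ∑ j, ρ j with hRdef
  have hR0 : 0 ≤ R := Finset.sum_nonneg fun l _ => hρ l
  set W : Fin k → ℝ := fun l => ∑ x, sliceSq c l x ^ (lam / 2) with hW
  have hW0 : ∀ l, 0 ≤ W l := fun l =>
    Finset.sum_nonneg fun x _ => Real.rpow_nonneg (sliceSq_nonneg c l x) _
  have hC : 0 ≤ √3 ^ k * M := by positivity
  obtain ⟨m, -, hm⟩ := Finset.exists_max_image Finset.univ W ⟨j, Finset.mem_univ j⟩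
  refine (Real.rpow_le_rpow (hW0 j) (hm j (Finset.mem_univ j)) (by linarith)).trans ?_
  rcases (hW0 m).eq_or_lt with h0 | h0
  · rw [← h0, Real.zero_rpow (by linarith)]
    exact hC
  have hprod : ∏ l, W l ^ ρ l ≤ W m ^ R := by
    rw [hRdef, Real.rpow_sum_of_pos h0]
    exact Finset.prod_le_prod (fun l _ => Real.rpow_nonneg (hW0 l) _) fun l _ =>
      Real.rpow_le_rpow (hW0 l) (hm l (Finset.mem_univ l)) (hρ l)
  have hp0 : 0 ≤ ∏ l, W l ^ ρ l := Finset.prod_nonneg fun l _ => Real.rpow_nonneg (hW0 l) _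
  have h1 : W m ^ (1 - R) ≤ (√3 ^ k * M) ^ (1 - 2 * R) * W m ^ (R * (1 - 2 * R) + R) := by
    refine (haux m).trans ?_
    rw [Real.rpow_add h0, Real.rpow_mul h0.le, ← mul_assoc,
      ← Real.mul_rpow hC (Real.rpow_nonneg h0.le _)]
    refine mul_le_mul (Real.rpow_le_rpow (mul_nonneg hC hp0) (by gcongr) (by linarith)) hprod hp0
      (by positivity)
  have h2 : (W m ^ (1 - R)) ^ (1 - 2 * R) ≤ (√3 ^ k * M) ^ (1 - 2 * R) := by
    have e : W m ^ (1 - R) = (W m ^ (1 - R)) ^ (1 - 2 * R) * W m ^ (R * (1 - 2 * R) + R) := by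
      rw [← Real.rpow_mul h0.le, ← Real.rpow_add h0]
      congr 1
      ring
    rw [e] at h1
    exact le_of_mul_le_mul_right h1 (Real.rpow_pos_of_pos h0 _)
  exact (Real.rpow_le_rpow_iff (Real.rpow_nonneg h0.le _) hC (by linarith)).1 h2

/-- At R = 1/2 the previous argument degenerates. Twisting one variable with ρ_j > 0 by its own
slice sums lowers R to 1/2 - ρ_j. The twisted slices are S_j^{1+2ρ_j}, whose power λ/2 for the new λ
is S_j; so S^{1/2+ρ_j} ≤ C S^{ρ_j} for the total sum S. -/
theorem FormBound.sqrt_sum_sq_le {ρ : Fin k → ℝ} (hρ : ∀ j, 0 ≤ ρ j)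
    (hR : ∑ j, ρ j = 1 / 2) {c : (Fin k → ι) → 𝕜} {M : ℝ} (h : FormBound ρ c M) (hM : 0 ≤ M) :
    √(∑ i, ‖c i‖ ^ 2) ≤ √3 ^ k * M := by
  obtain ⟨j, -, hj⟩ : ∃ j ∈ Finset.univ, 0 < ρ j :=
    Finset.exists_lt_of_sum_lt (by simp [hR])
  have hQ := sliceSq_nonneg c
  have hσ := h.twist hM (σ := Function.update ρ j 0) (v := fun _ x => sliceSq c j x)
    (fun l => by by_cases hl : l = j <;> simp [hl, hρ])
    (fun l => by by_cases hl : l = j <;> simp [hl, hρ])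
    (fun _ x => hQ j x)
  have hprod : ∀ f : Fin k → ℝ, ∏ l, f l ^ (ρ l - Function.update ρ j 0 l) = f j ^ ρ j := by
    intro f
    rw [Finset.prod_eq_single j]
    · simp
    · intro l _ hl
      simp [Function.update_of_ne hl]
    · simp
  simp_rw [hprod] at hσ
  rw [sum_sliceSq] at hσ
  set S := ∑ i, ‖c i‖ ^ 2 with hS
  have hS0 : 0 ≤ S := Finset.sum_nonneg fun i _ => by positivity
  have hsum : ∑ l, Function.update ρ j 0 l = 1 / 2 - ρ j := by
    rw [Finset.sum_update_of_mem (Finset.mem_univ j), zero_add, ← hR,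
      ← Finset.sum_sdiff (Finset.subset_univ {j})]
    simp
  have hd : (1 / 2 + ρ j) ≠ 0 := by positivity
  have := hσ.sum_sliceSq_le_of_lt
    (fun l => by by_cases hl : l = j <;> simp [hl, hρ])
    (by rw [hsum]; linarith) (by positivity) (lam := 1 / (1 / 2 + ρ j))
    (by rw [hsum]; field_simp; ring) j
  have hslice : ∀ x, sliceSq (fun i => ((sliceSq c j (i j) ^ ρ j : ℝ) : 𝕜) * c i) j x ^
      (1 / (1 / 2 + ρ j) / 2) = sliceSq c j x := by
    intro x
    have e1 : sliceSq (fun i => ((sliceSq c j (i j) ^ ρ j : ℝ) : 𝕜) * c i) j x =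
        sliceSq c j x ^ (1 + 2 * ρ j) := by
      rw [← mul_rpow_sub_one (hQ j x) (by positivity)]
      conv_lhs => rw [sliceSq]
      conv_rhs => rw [sliceSq, Finset.sum_mul]
      refine Finset.sum_congr rfl fun i hi => ?_
      rw [(Finset.mem_filter.1 hi).2, norm_mul, RCLike.norm_ofReal,
        abs_of_nonneg (Real.rpow_nonneg (hQ _ _) _), mul_pow, ← Real.rpow_mul_natCast (hQ _ _)]
      rw [mul_comm, ← sliceSq]
      congr 2
      push_cast
      ring
    rw [e1, ← Real.rpow_mul (hQ j x)]
    have : (1 + 2 * ρ j) * (1 / (1 / 2 + ρ j) / 2) = 1 := by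
      have := hρ j
      field_simp
    rw [this, Real.rpow_one]
  simp_rw [hslice] at this
  rw [sum_sliceSq, hsum, ← hS] at this
  rcases hS0.eq_or_lt with h0 | h0
  · rw [← h0, Real.sqrt_zero]
    positivity
  have e : (1 : ℝ) - (1 / 2 - ρ j) = 1 / 2 + ρ j := by ring
  rw [e, Real.rpow_add h0, ← mul_assoc] at this
  rw [Real.sqrt_eq_rpow]
  exact le_of_mul_le_mul_right this (Real.rpow_pos_of_pos h0 _)

theorem FormBound.sum_sliceSq_le {ρ : Fin k → ℝ} (hρ : ∀ j, 0 ≤ ρ j)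
    (hR : ∑ j, ρ j ≤ 1 / 2) {c : (Fin k → ι) → 𝕜} {M : ℝ} (h : FormBound ρ c M) (hM : 0 ≤ M)
    {lam : ℝ} (hlam : lam * (1 - ∑ j, ρ j) = 1) (j : Fin k) :
    (∑ x, sliceSq c j x ^ (lam / 2)) ^ (1 - ∑ j, ρ j) ≤ √3 ^ k * M := by
  rcases hR.eq_or_lt with hR | hR
  · rw [hR] at hlam ⊢
    have : lam = 2 := by linarith
    subst this
    have := h.sqrt_sum_sq_le hρ hR hM
    rw [Real.sqrt_eq_rpow] at this
    convert this using 2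
    · simp [sum_sliceSq]
    · norm_num
  · exact h.sum_sliceSq_le_of_lt hρ hR hM hlam j

/-- Twisting by the slice sums of |c|^λ scales the exponents down to total 1/2, where the ℓ₂ bound
holds; it gives S^{1/2} ≤ C S^{R-1/2} with S = ∑|c|^λ. -/
theorem FormBound.sum_norm_rpow_le {ρ : Fin k → ℝ} (hρ : ∀ j, 0 ≤ ρ j)
    (hR : 1 / 2 ≤ ∑ j, ρ j) (hR1 : ∑ j, ρ j < 1) {c : (Fin k → ι) → 𝕜} {M : ℝ}
    (h : FormBound ρ c M) (hM : 0 ≤ M) :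
    (∑ i, ‖c i‖ ^ (1 / (1 - ∑ j, ρ j))) ^ (1 - ∑ j, ρ j) ≤ √3 ^ k * M := by
  set R := ∑ j, ρ j with hRdef
  have hR0 : 0 < R := by linarith
  have hR1' : 0 < 1 - R := by linarith
  set lam := 1 / (1 - R) with hlam
  have hlam0 : 0 < lam := by positivity
  let v : Fin k → ι → ℝ := fun j x => ∑ i with i j = x, ‖c i‖ ^ lam
  have hv0 : ∀ j x, 0 ≤ v j x := fun j x => Finset.sum_nonneg fun i _ => by positivity
  set S := ∑ i, ‖c i‖ ^ lam with hS
  have hS0 : 0 ≤ S := Finset.sum_nonneg fun i _ => by positivity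
  have hvS : ∀ j, ∑ x, v j x = S := fun j => Finset.sum_fiberwise _ _ _
  have hσ := h.twist hM (σ := fun l => ρ l / (2 * R)) (v := v)
    (fun l => by have := hρ l; positivity)
    (fun l => div_le_self (hρ l) (by linarith)) hv0
  have h1 := hσ.sqrt_sum_sq_le (fun l => by have := hρ l; positivity)
    (by rw [← Finset.sum_div, ← hRdef]; field_simp)
    (mul_nonneg hM (Finset.prod_nonneg fun l _ => Real.rpow_nonneg
      (Finset.sum_nonneg fun x _ => hv0 l x) _))
  simp_rw [hvS] at h1
  rcases hS0.eq_or_lt with h0 | h0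
  · rw [← h0, Real.zero_rpow hR1'.ne']
    positivity
  have hT : ∑ l, (ρ l - ρ l / (2 * R)) = R - 1 / 2 := by
    rw [Finset.sum_sub_distrib, ← Finset.sum_div, ← hRdef]
    field_simp
  rw [← Real.rpow_sum_of_pos h0, hT, ← mul_assoc] at h1
  -- Each slice sum dominates |c_i|^λ, and λ(2R-1) + 2 = λ.
  have hlow : √S ≤ √(∑ i, ‖((∏ j, v j (i j) ^ (ρ j - ρ j / (2 * R)) : ℝ) : 𝕜) * c i‖ ^ 2) := by
    refine Real.sqrt_le_sqrt (Finset.sum_le_sum fun i _ => ?_)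
    rcases (norm_nonneg (c i)).eq_or_lt with hc | hc
    · rw [← hc, Real.zero_rpow hlam0.ne']
      positivity
    have hcv : ∀ l, ‖c i‖ ^ lam ≤ v l (i l) := fun l =>
      Finset.single_le_sum (f := fun i => ‖c i‖ ^ lam) (fun _ _ => by positivity) (by simp)
    have h2 : (‖c i‖ ^ lam) ^ (R - 1 / 2) ≤ ∏ j, v j (i j) ^ (ρ j - ρ j / (2 * R)) := by
      rw [← hT, Real.rpow_sum_of_pos (by positivity)]
      exact Finset.prod_le_prod (fun l _ => by positivity) fun l _ =>
        Real.rpow_le_rpow (by positivity) (hcv l)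
          (sub_nonneg.2 (div_le_self (hρ l) (by linarith)))
    rw [norm_mul, RCLike.norm_ofReal, abs_of_nonneg
      (Finset.prod_nonneg fun l _ => Real.rpow_nonneg (hv0 _ _) _)]
    calc ‖c i‖ ^ lam = ((‖c i‖ ^ lam) ^ (R - 1 / 2) * ‖c i‖) ^ 2 := by
          rw [mul_pow, ← Real.rpow_mul hc.le, ← Real.rpow_mul_natCast hc.le, ← Real.rpow_natCast,
            ← Real.rpow_add hc]
          congr 1
          rw [hlam]
          push_cast
          field_simp
          ring
      _ ≤ _ := by gcongr
  have h3 := hlow.trans h1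
  have e : √S = S ^ (1 - R) * S ^ (R - 1 / 2) := by
    rw [← Real.rpow_add h0, Real.sqrt_eq_rpow]
    congr 1
    ring
  rw [e] at h3
  exact le_of_mul_le_mul_right h3 (Real.rpow_pos_of_pos h0 _)

end Summability

/-! ### Hölder and Minkowski for series in [0, ∞] -/

section ENNRealSums

open MeasureTheory

theorem lintegral_count_nat (f : ℕ → ℝ≥0∞) : ∫⁻ x, f x ∂Measure.count = ∑' x, f x :=
  lintegral_count' (measurable_of_countable f)

theorem tsum_prod_rpow_le {κ : Type*} (s : Finset κ) (f : κ → ℕ → ℝ≥0∞) (w : κ → ℝ)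
    (hw : ∀ l ∈ s, 0 ≤ w l) (hw1 : ∑ l ∈ s, w l = 1) :
    ∑' x, ∏ l ∈ s, f l x ^ w l ≤ ∏ l ∈ s, (∑' x, f l x) ^ w l := by
  simpa only [lintegral_count_nat] using ENNReal.lintegral_prod_norm_pow_le (μ := Measure.count) s
    (fun l _ => (measurable_of_countable (f l)).aemeasurable) hw1 hw

theorem tsum_iSup_of_monotone {f : ℕ → ℕ → ℝ≥0∞} (hf : Monotone f) :
    ∑' x, ⨆ n, f n x = ⨆ n, ∑' x, f n x := by
  simpa only [lintegral_count_nat] using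
    lintegral_iSup (μ := Measure.count) (fun n => measurable_of_countable (f n)) hf

theorem iSup_rpow {ι : Sort*} (f : ι → ℝ≥0∞) {y : ℝ} (hy : 0 < y) :
    (⨆ n, f n) ^ y = ⨆ n, f n ^ y :=
  (ENNReal.orderIsoRpow y hy).map_iSup f

theorem prod_rpow_eq_rpow_sum {κ : Type*} [Fintype κ] (a : ℝ≥0∞) {w : κ → ℝ}
    (hw : ∀ l, 0 ≤ w l) : ∏ l, a ^ w l = a ^ ∑ l, w l := by
  classical
  induction (Finset.univ : Finset κ) using Finset.induction_on with
  | empty => simp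
  | insert l s hl ih =>
    rw [Finset.prod_insert hl, Finset.sum_insert hl, ih,
      ENNReal.rpow_add_of_nonneg _ _ (hw l) (Finset.sum_nonneg fun l _ => hw l)]

theorem rpow_tsum_sum_le (g : ℕ → ℕ → ℝ≥0∞) {p : ℝ} (hp : 1 ≤ p) (n : ℕ) :
    (∑' y, (∑ x ∈ Finset.range n, g x y) ^ p) ^ (1 / p) ≤
      ∑ x ∈ Finset.range n, (∑' y, g x y ^ p) ^ (1 / p) := by
  have hp0 : 0 < p := one_pos.trans_le hp
  induction n with
  | zero => simp [ENNReal.zero_rpow_of_pos, hp0]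
  | succ n ih =>
    simp only [Finset.sum_range_succ]
    refine le_trans ?_ (add_le_add_left ih _)
    simpa only [lintegral_count_nat, Pi.add_apply] using
      ENNReal.lintegral_Lp_add_le (μ := Measure.count)
        (measurable_of_countable fun y => ∑ x ∈ Finset.range n, g x y).aemeasurable
        (measurable_of_countable (g n)).aemeasurable hp

/-- **Minkowski's inequality** for double series. -/
theorem rpow_tsum_tsum_le (g : ℕ → ℕ → ℝ≥0∞) {p : ℝ} (hp : 1 ≤ p) :
    (∑' y, (∑' x, g x y) ^ p) ^ (1 / p) ≤ ∑' x, (∑' y, g x y ^ p) ^ (1 / p) := by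
  have hp0 : 0 < p := one_pos.trans_le hp
  simp_rw [ENNReal.tsum_eq_iSup_nat (f := fun x => g x _), iSup_rpow _ hp0]
  rw [tsum_iSup_of_monotone, iSup_rpow _ (one_div_pos.2 hp0)]
  · refine iSup_le fun n => (rpow_tsum_sum_le g hp n).trans (ENNReal.sum_le_tsum _)
  · intro m n hmn y
    exact ENNReal.rpow_le_rpow (Finset.sum_le_sum_of_subset (Finset.range_mono hmn)) hp0.le

theorem rpow_tsum_le_tsum_rpow (a : ℕ → ℝ≥0∞) {p : ℝ} (hp : 0 < p) (hp1 : p ≤ 1) :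
    (∑' x, a x) ^ p ≤ ∑' x, a x ^ p := by
  rw [ENNReal.tsum_eq_iSup_nat, iSup_rpow _ hp]
  refine iSup_le fun n => le_trans ?_ (ENNReal.sum_le_tsum (Finset.range n))
  induction n with
  | zero => simp [ENNReal.zero_rpow_of_pos hp]
  | succ n ih =>
    rw [Finset.sum_range_succ, Finset.sum_range_succ]
    exact (ENNReal.rpow_add_le_add_rpow _ _ hp.le hp1).trans (add_le_add_left ih _)

theorem tsum_fin_succ_pi {k : ℕ} (F : (Fin (k + 1) → ℕ) → ℝ≥0∞) :
    ∑' i, F i = ∑' x, ∑' v : Fin k → ℕ, F (Fin.cons x v) := by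
  rw [← ENNReal.tsum_prod, ← (Fin.consEquiv fun _ : Fin (k + 1) => ℕ).tsum_eq]
  rfl

end ENNRealSums

/-! ### Interpolation and comparison of mixed sums -/

section MixedSum

theorem mixedSum_succ {k : ℕ} (q : Fin (k + 1) → ℝ) (f : (Fin (k + 1) → ℕ) → ℝ≥0∞) :
    mixedSum q f =
      (∑' x : ℕ, mixedSum (Fin.tail q) (fun v => f (Fin.cons x v)) ^ q 0) ^ (1 / q 0) := rfl

theorem mixedSum_mono : ∀ {k : ℕ} {q : Fin k → ℝ} (_ : ∀ j, 0 < q j)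
    {f g : (Fin k → ℕ) → ℝ≥0∞} (_ : f ≤ g), mixedSum q f ≤ mixedSum q g
  | 0, _, _, _, _, h => h _
  | k + 1, q, hq, f, g, h => by
    have h0 := hq 0
    rw [mixedSum_succ, mixedSum_succ]
    refine ENNReal.rpow_le_rpow (ENNReal.tsum_le_tsum fun x => ENNReal.rpow_le_rpow ?_ h0.le)
      (by positivity)
    exact mixedSum_mono (fun j => hq j.succ) fun v => h _

theorem mixedSum_iSup : ∀ {k : ℕ} {q : Fin k → ℝ} (_ : ∀ j, 0 < q j)
    {f : ℕ → (Fin k → ℕ) → ℝ≥0∞} (_ : Monotone f),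
    mixedSum q (fun i => ⨆ n, f n i) = ⨆ n, mixedSum q (f n)
  | 0, _, _, _, _ => rfl
  | k + 1, q, hq, f, h => by
    have h0 := hq 0
    simp_rw [mixedSum_succ]
    rw [← iSup_rpow _ (one_div_pos.2 h0), ← tsum_iSup_of_monotone]
    · simp_rw [← iSup_rpow _ h0]
      congr 2
      funext x
      congr 1
      exact mixedSum_iSup (fun j => hq j.succ) fun m n hmn v => h hmn _
    · intro m n hmn x
      exact ENNReal.rpow_le_rpow (mixedSum_mono (fun j => hq j.succ) fun v => h hmn _) h0.le

/-- Interpolation of mixed sums. -/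
theorem mixedSum_prod_rpow_le {κ : Type*} [Fintype κ] : ∀ {k : ℕ} {q : Fin k → ℝ}
    {e : κ → Fin k → ℝ} {w : κ → ℝ} (_ : ∀ j, 0 < q j) (_ : ∀ l j, 0 < e l j) (_ : ∀ l, 0 ≤ w l)
    (_ : ∀ j, ∑ l, w l / e l j = 1 / q j) (f : κ → (Fin k → ℕ) → ℝ≥0∞),
    mixedSum q (fun i => ∏ l, f l i ^ w l) ≤ ∏ l, mixedSum (e l) (f l) ^ w l
  | 0, _, _, _, _, _, _, _, _ => le_rfl
  | k + 1, q, e, w, hq, he, hw, hqe, f => by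
    have h0 := hq 0
    simp_rw [mixedSum_succ]
    -- The outer exponents w_l q₀ / e_{l,0} add up to 1, so Hölder applies to the sum over x.
    have ih : ∀ x : ℕ, mixedSum (Fin.tail q) (fun v => ∏ l, f l (Fin.cons x v) ^ w l) ^ q 0 ≤
        ∏ l, (mixedSum (Fin.tail (e l)) (fun v => f l (Fin.cons x v)) ^ e l 0) ^
          (w l * q 0 / e l 0) := by
      intro x
      refine (ENNReal.rpow_le_rpow (mixedSum_prod_rpow_le (q := Fin.tail q)
        (e := fun l => Fin.tail (e l)) (fun j => hq j.succ) (fun l j => he l j.succ) hw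
        (fun j => hqe j.succ) fun l v => f l (Fin.cons x v)) h0.le).trans (le_of_eq ?_)
      rw [← ENNReal.prod_rpow_of_nonneg h0.le]
      refine Finset.prod_congr rfl fun l _ => ?_
      have := (he l 0).ne'
      rw [← ENNReal.rpow_mul, ← ENNReal.rpow_mul]
      congr 1
      field_simp
    refine (ENNReal.rpow_le_rpow ((ENNReal.tsum_le_tsum ih).trans
      (tsum_prod_rpow_le _ _ _ (fun l _ => ?_) ?_)) (by positivity)).trans (le_of_eq ?_)
    · exact div_nonneg (mul_nonneg (hw l) h0.le) (he l 0).le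
    · simp_rw [mul_div_right_comm]
      rw [← Finset.sum_mul, hqe 0, one_div, inv_mul_cancel₀ h0.ne']
    · rw [← ENNReal.prod_rpow_of_nonneg (by positivity)]
      refine Finset.prod_congr rfl fun l _ => ?_
      have := (he l 0).ne'
      rw [← ENNReal.rpow_mul, ← ENNReal.rpow_mul]
      congr 1
      field_simp

theorem mixedSum_two : ∀ {k : ℕ} (f : (Fin k → ℕ) → ℝ≥0∞),
    mixedSum (fun _ => 2) f = (∑' i, f i ^ (2 : ℝ)) ^ (1 / 2 : ℝ)
  | 0, f => by
    rw [tsum_fintype, Fintype.sum_unique, ← ENNReal.rpow_mul]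
    norm_num
    rfl
  | k + 1, f => by
    rw [mixedSum_succ, tsum_fin_succ_pi]
    congr 2
    funext x
    have : Fin.tail (fun _ : Fin (k + 1) => (2 : ℝ)) = fun _ => 2 := rfl
    rw [this, mixedSum_two, ← ENNReal.rpow_mul]
    norm_num

/-- The sum of `f_i²` over the multi-indices with `i_j = x`. -/
noncomputable def slice {k : ℕ} (f : (Fin k → ℕ) → ℝ≥0∞) (j : Fin k) (x : ℕ) : ℝ≥0∞ :=
  ∑' i : Fin k → ℕ, if i j = x then f i ^ (2 : ℝ) else 0

theorem tsum_slice {k : ℕ} (f : (Fin k → ℕ) → ℝ≥0∞) (j : Fin k) :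
    ∑' x, slice f j x = ∑' i, f i ^ (2 : ℝ) := by
  simp_rw [slice]
  rw [ENNReal.tsum_comm]
  simp

/-- With λ outermost this is an equality. Otherwise Minkowski with exponent 2/λ ≥ 1 moves the λ-sum
outside the ℓ₂-sums that precede it. -/
theorem mixedSum_update_le {lam : ℝ} (hlam : 0 < lam) (hlam2 : lam ≤ 2) :
    ∀ {k : ℕ} (j : Fin k) (f : (Fin k → ℕ) → ℝ≥0∞),
      mixedSum (Function.update (fun _ => 2) j lam) f ≤
        (∑' x, slice f j x ^ (lam / 2)) ^ (1 / lam)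
  | k + 1, j, f => by
    rw [mixedSum_succ]
    refine Fin.cases ?_ (fun l => ?_) j
    · have : Fin.tail (Function.update (fun _ : Fin (k + 1) => (2 : ℝ)) 0 lam) = fun _ => 2 := by
        funext l
        simp [Fin.tail]
      rw [this, Function.update_self]
      refine le_of_eq ?_
      congr 2
      funext x
      rw [mixedSum_two, ← ENNReal.rpow_mul, slice, tsum_fin_succ_pi, tsum_eq_single x]
      · simp only [Fin.cons_zero, if_true]
        congr 1
        ring
      · intro y hy
        simp [hy]
    · have : Fin.tail (Function.update (fun _ : Fin (k + 1) => (2 : ℝ)) l.succ lam) =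
          Function.update (fun _ => 2) l lam := by
        funext i
        by_cases h : i = l
        · subst h; simp [Fin.tail]
        · simp [Fin.tail, h]
      rw [this, Function.update_of_ne (Fin.succ_ne_zero l).symm]
      set A : ℕ → ℕ → ℝ≥0∞ := fun y x => slice (fun v => f (Fin.cons y v)) l x with hA
      have h1 : ∀ y, mixedSum (Function.update (fun _ => 2) l lam)
          (fun v => f (Fin.cons y v)) ^ (2 : ℝ) ≤ (∑' x, A y x ^ (lam / 2)) ^ (2 / lam) := by
        intro y
        refine (ENNReal.rpow_le_rpow (mixedSum_update_le hlam hlam2 l _) (by norm_num)).trans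
          (le_of_eq ?_)
        rw [← ENNReal.rpow_mul]
        congr 1
        ring
      have h2 := rpow_tsum_tsum_le (fun x y => A y x ^ (lam / 2)) (p := 2 / lam)
        (by rw [le_div_iff₀ hlam]; linarith)
      have h3 : ∀ x, ∑' y, (A y x ^ (lam / 2)) ^ (2 / lam) = slice f l.succ x := by
        intro x
        rw [slice, tsum_fin_succ_pi]
        refine tsum_congr fun y => ?_
        rw [← ENNReal.rpow_mul, div_mul_div_comm, mul_comm lam, div_self (by positivity),
          ENNReal.rpow_one]
        simp only [hA, slice, Fin.cons_succ]
      simp_rw [h3, one_div_div] at h2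
      calc _ ≤ (∑' y, (∑' x, A y x ^ (lam / 2)) ^ (2 / lam)) ^ (1 / 2 : ℝ) :=
            ENNReal.rpow_le_rpow (ENNReal.tsum_le_tsum h1) (by norm_num)
        _ = ((∑' y, (∑' x, A y x ^ (lam / 2)) ^ (2 / lam)) ^ (lam / 2)) ^ (1 / lam) := by
            rw [← ENNReal.rpow_mul]
            congr 1
            field_simp
        _ ≤ _ := ENNReal.rpow_le_rpow h2 (by positivity)

/-- A mixed sum is controlled by the `(λ, 2)`-sums in each of the variables. -/
theorem mixedSum_le_of_slice {k : ℕ} (hk : 1 ≤ k) {lam : ℝ} (hlam : 0 < lam) (hlam2 : lam ≤ 2)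
    {q : Fin k → ℝ} (hq : ∀ j, lam ≤ q j ∧ q j ≤ 2)
    (hs : ∑ j, 1 / q j ≤ 1 / lam + ((k : ℝ) - 1) / 2) {f : (Fin k → ℕ) → ℝ≥0∞} {C : ℝ≥0∞}
    (hf : ∀ j, (∑' x, slice f j x ^ (lam / 2)) ^ (1 / lam) ≤ C) : mixedSum q f ≤ C := by
  have hq0 : ∀ j, 0 < q j := fun j => hlam.trans_le (hq j).1
  have htwo : mixedSum (fun _ => 2) f ≤ C := by
    let j₀ : Fin k := ⟨0, hk⟩
    refine le_trans ?_ (hf j₀)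
    rw [mixedSum_two, ← tsum_slice f j₀]
    calc (∑' x, slice f j₀ x) ^ (1 / 2 : ℝ) = ((∑' x, slice f j₀ x) ^ (lam / 2)) ^ (1 / lam) := by
          rw [← ENNReal.rpow_mul]
          congr 1
          field_simp
      _ ≤ _ := ENNReal.rpow_le_rpow (rpow_tsum_le_tsum_rpow _ (by positivity) (by linarith))
          (by positivity)
  rcases hlam2.eq_or_lt with h2 | h2
  · have : q = fun _ => 2 := funext fun j => le_antisymm (hq j).2 (h2 ▸ (hq j).1)
    rw [this]
    exact htwo
  have hd : 0 < 1 / lam - 1 / 2 := sub_pos.2 (one_div_lt_one_div_of_lt hlam h2)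
  -- The point (1/q_j) is the combination, with weights θ_j, of the points having 1/λ in place j and
  -- 1/2 elsewhere; the leftover weight goes to (1/2, …, 1/2). The condition on ∑ 1/q_j says exactly
  -- that this leftover is nonnegative.
  let θ : Fin k → ℝ := fun j => (1 / q j - 1 / 2) / (1 / lam - 1 / 2)
  have hθ : ∀ j, 0 ≤ θ j := fun j =>
    div_nonneg (sub_nonneg.2 (one_div_le_one_div_of_le (hq0 j) (hq j).2)) hd.le
  have hθ1 : ∑ j, θ j ≤ 1 := by
    rw [← Finset.sum_div, div_le_one hd, Finset.sum_sub_distrib]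
    simp only [Finset.sum_const, Finset.card_univ, Fintype.card_fin, nsmul_eq_mul]
    linarith
  have hθd : ∀ j, θ j * (1 / lam - 1 / 2) = 1 / q j - 1 / 2 := fun j =>
    div_mul_cancel₀ _ hd.ne'
  clear_value θ
  let w : Option (Fin k) → ℝ := fun o => o.elim (1 - ∑ j, θ j) θ
  let e : Option (Fin k) → Fin k → ℝ := fun o =>
    o.elim (fun _ => 2) fun j => Function.update (fun _ => 2) j lam
  have hw : ∀ o, 0 ≤ w o := by
    rintro (_ | j)
    exacts [sub_nonneg.2 hθ1, hθ j]
  have hw1 : ∑ o, w o = 1 := by simp [w, Fintype.sum_option]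
  have he : ∀ o j, 0 < e o j := by
    rintro (_ | l) j
    · exact two_pos
    · by_cases h : j = l
      · subst h; simpa [e] using hlam
      · simp [e, h]
  have hint : mixedSum q (fun i => ∏ o, f i ^ w o) ≤ ∏ o, mixedSum (e o) f ^ w o := by
    refine mixedSum_prod_rpow_le hq0 he hw (fun j => ?_) fun _ => f
    have h1 : ∀ l, θ l / Function.update (fun _ : Fin k => (2 : ℝ)) l lam j =
        θ l / 2 + if l = j then θ j * (1 / lam - 1 / 2) else 0 := by
      intro l
      by_cases h : l = j
      · subst h; simp; ring
      · simp [h, Ne.symm h]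
    simp only [Fintype.sum_option, w, e, Option.elim]
    rw [Finset.sum_congr rfl fun l _ => h1 l, Finset.sum_add_distrib, ← Finset.sum_div]
    simp only [Finset.sum_ite_eq', Finset.mem_univ, if_true]
    rw [hθd]
    ring
  simp_rw [prod_rpow_eq_rpow_sum _ hw, hw1, ENNReal.rpow_one] at hint
  refine hint.trans ?_
  calc ∏ o, mixedSum (e o) f ^ w o ≤ ∏ o, C ^ w o := by
        refine Finset.prod_le_prod' fun o _ => ENNReal.rpow_le_rpow ?_ (hw o)
        rcases o with _ | j
        · exact htwo
        · exact (mixedSum_update_le hlam hlam2 j f).trans (hf j)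
    _ = C := by rw [prod_rpow_eq_rpow_sum _ hw, hw1, ENNReal.rpow_one]

end MixedSum

/-! ### Reduction to finite boxes -/

section Truncation

variable {k : ℕ}

/-- The family `f` cut off outside the box `[0, N)^k`. -/
noncomputable def truncate (N : ℕ) (f : (Fin k → ℕ) → ℝ≥0∞) (i : Fin k → ℕ) : ℝ≥0∞ :=
  if ∀ j, i j < N then f i else 0

theorem truncate_monotone (f : (Fin k → ℕ) → ℝ≥0∞) : Monotone fun N => truncate N f := by
  intro m n hmn i
  simp only [truncate]
  split_ifs with h1 h2
  · exact le_rfl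
  · exact absurd (fun j => (h1 j).trans_le hmn) h2
  · exact zero_le
  · exact zero_le

theorem iSup_truncate (f : (Fin k → ℕ) → ℝ≥0∞) : (fun i => ⨆ N, truncate N f i) = f := by
  funext i
  refine le_antisymm (iSup_le fun N => ?_) (le_iSup_of_le (Finset.univ.sup i + 1) ?_)
  · simp only [truncate]
    split_ifs
    exacts [le_rfl, zero_le]
  · rw [truncate, if_pos fun j => Nat.lt_succ_of_le (Finset.le_sup (Finset.mem_univ j))]

theorem mixedSum_le_of_truncate {q : Fin k → ℝ} (hq : ∀ j, 0 < q j) {f : (Fin k → ℕ) → ℝ≥0∞}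
    {C : ℝ≥0∞} (h : ∀ N, mixedSum q (truncate N f) ≤ C) : mixedSum q f ≤ C := by
  rw [← iSup_truncate f, mixedSum_iSup hq (truncate_monotone f)]
  exact iSup_le h

theorem le_mixedSum : ∀ {k : ℕ} {q : Fin k → ℝ} (_ : ∀ j, 0 < q j) (f : (Fin k → ℕ) → ℝ≥0∞)
    (i : Fin k → ℕ), f i ≤ mixedSum q f
  | 0, _, _, f, i => le_of_eq (congrArg f (Subsingleton.elim _ _))
  | k + 1, q, hq, f, i => by
    have h0 := hq 0
    have h1 := le_mixedSum (q := Fin.tail q) (fun j => hq j.succ)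
      (fun v => f (Fin.cons (i 0) v)) (Fin.tail i)
    rw [Fin.cons_self_tail] at h1
    rw [mixedSum_succ, one_div, ENNReal.le_rpow_inv_iff h0]
    exact (ENNReal.rpow_le_rpow h1 h0.le).trans (ENNReal.le_tsum (i 0))

theorem tsum_nat_eq_sum_fin {N : ℕ} {g : ℕ → ℝ≥0∞} (h : ∀ x, N ≤ x → g x = 0) :
    ∑' x, g x = ∑ x : Fin N, g x := by
  rw [tsum_eq_sum (s := Finset.range N) fun x hx => h x (by simpa using hx), Finset.sum_range]

theorem tsum_pi_eq_sum_fin {N : ℕ} {g : (Fin k → ℕ) → ℝ≥0∞}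
    (h : ∀ i, (∃ j, N ≤ i j) → g i = 0) :
    ∑' i, g i = ∑ i : Fin k → Fin N, g fun j => i j := by
  have hinj : Function.Injective fun (i : Fin k → Fin N) (j : Fin k) => (i j : ℕ) :=
    fun a b hab => funext fun j => Fin.ext (congrFun hab j)
  rw [← hinj.tsum_eq, tsum_fintype]
  intro i hi
  have : ∀ j, i j < N := by
    by_contra hc
    push Not at hc
    exact hi (h i hc)
  exact ⟨fun j => ⟨i j, this j⟩, rfl⟩

end Truncation

/-! ### From bounded coefficients to the optimal constants -/

section Bounds

variable {𝕜 : Type*} [RCLike 𝕜] {k : ℕ}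

theorem slice_truncate (c : (Fin k → ℕ) → 𝕜) (N : ℕ) (j : Fin k) (x : Fin N) :
    slice (truncate N fun i => ‖c i‖ₑ) j x =
      ENNReal.ofReal (sliceSq (fun i : Fin k → Fin N => c fun l => i l) j x) := by
  rw [slice, tsum_pi_eq_sum_fin (N := N), sliceSq, Finset.sum_filter,
    ENNReal.ofReal_sum_of_nonneg fun i _ => by positivity]
  · refine Finset.sum_congr rfl fun i _ => ?_
    simp only [Fin.val_inj, truncate, Fin.is_lt, implies_true, if_true]
    split_ifs
    · rw [← ofReal_norm, ENNReal.ofReal_rpow_of_nonneg (norm_nonneg _) (by norm_num)]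
      norm_num
    · simp
  · rintro i ⟨l, hl⟩
    have : ¬ ∀ j, i j < N := fun h => absurd (h l) (not_lt.2 hl)
    simp [truncate, this]

theorem slice_truncate_of_le (f : (Fin k → ℕ) → ℝ≥0∞) {N : ℕ} (j : Fin k) {x : ℕ}
    (hx : N ≤ x) : slice (truncate N f) j x = 0 := by
  rw [slice, ENNReal.tsum_eq_zero]
  intro i
  split_ifs with h
  · have : ¬ ∀ j, i j < N := fun h' => absurd (h' j) (not_lt.2 (h ▸ hx))
    simp [truncate, this]
  · rfl

theorem mixedSum_le_of_formBound (hk : 1 ≤ k) {ρ q : Fin k → ℝ} (hρ : ∀ j, 0 ≤ ρ j)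
    (hR : ∑ j, ρ j ≤ 1 / 2) (hq : ∀ j, (1 - ∑ j, ρ j)⁻¹ ≤ q j ∧ q j ≤ 2)
    (hs : ∑ j, 1 / q j ≤ ((k : ℝ) + 1) / 2 - ∑ j, ρ j) {c : (Fin k → ℕ) → 𝕜} {M : ℝ}
    (hM : 0 ≤ M) (h : ∀ N, FormBound ρ (fun i : Fin k → Fin N => c fun j => i j) M) :
    mixedSum q (fun i => ‖c i‖ₑ) ≤ ENNReal.ofReal (√3 ^ k * M) := by
  set R := ∑ j, ρ j with hRdef
  have hR1 : 0 < 1 - R := by linarith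
  have hlam : 0 < (1 - R)⁻¹ := inv_pos.2 hR1
  refine mixedSum_le_of_truncate (fun j => hlam.trans_le (hq j).1) fun N => ?_
  refine mixedSum_le_of_slice hk hlam ?_ hq ?_ fun j => ?_
  · rw [inv_le_comm₀ hR1 two_pos]
    linarith
  · rw [one_div, inv_inv]
    linarith
  · have h0 : 0 < (1 - R)⁻¹ / 2 := by positivity
    rw [tsum_nat_eq_sum_fin (N := N) fun x hx => by
      rw [slice_truncate_of_le _ _ hx, ENNReal.zero_rpow_of_pos h0]]
    have hnn := sliceSq_nonneg (fun i : Fin k → Fin N => c fun l => i l) j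
    simp_rw [slice_truncate]
    rw [Finset.sum_congr rfl fun x _ => ENNReal.ofReal_rpow_of_nonneg (hnn x) h0.le,
      ← ENNReal.ofReal_sum_of_nonneg fun x _ => Real.rpow_nonneg (hnn x) _,
      ENNReal.ofReal_rpow_of_nonneg (Finset.sum_nonneg fun x _ => Real.rpow_nonneg (hnn x) _)
        (by positivity), one_div, inv_inv]
    exact ENNReal.ofReal_le_ofReal
      ((h N).sum_sliceSq_le hρ hR hM (inv_mul_cancel₀ hR1.ne') j)

/-- The infimum is itself admissible. Its finiteness supplies a member of S, which settles b = 0,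
where division is impossible. -/
theorem le_sInf_mul {S : Set ℝ≥0∞} {a b : ℝ≥0∞} (hS : sInf S < ∞) (hb : b ≠ ∞)
    (h : ∀ C ∈ S, a ≤ C * b) : a ≤ sInf S * b := by
  obtain ⟨C₀, hC₀, hlt⟩ := sInf_lt_iff.1 hS
  by_cases hb0 : b = 0
  · simpa [hb0] using h C₀ hC₀
  · rw [← ENNReal.div_le_iff hb0 hb]
    exact le_sInf fun C hC => (ENNReal.div_le_iff hb0 hb).2 (h C hC)

theorem absInv_blockExp (n : Fin k → ℕ) (p : Fin k → ℝ≥0∞) :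
    absInv (blockExp n p) = ∑ j, n j * ((p j)⁻¹).toReal := by
  rw [absInv, Fintype.sum_sigma]
  simp [blockExp]

theorem toReal_inv_div (n : ℕ) (hn : 1 ≤ n) (p : ℝ≥0∞) :
    ((p / (n : ℝ≥0∞))⁻¹).toReal = n * (p⁻¹).toReal := by
  rw [ENNReal.inv_div (Or.inl (ENNReal.natCast_ne_top n))
    (Or.inl (by exact_mod_cast (by omega : n ≠ 0))), div_eq_mul_inv, ENNReal.toReal_mul,
    ENNReal.toReal_natCast]

theorem one_le_of_toReal_inv_le_one {r : ℝ≥0∞} (h0 : r ≠ 0) (h : (r⁻¹).toReal ≤ 1) : 1 ≤ r := by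
  rw [← ENNReal.inv_le_one]
  rwa [← ENNReal.toReal_one, ENNReal.toReal_le_toReal (by simpa using h0) ENNReal.one_ne_top] at h

theorem fact_one_le_div {n : Fin k → ℕ} {p : Fin k → ℝ≥0∞} [hp : ∀ j, Fact (1 ≤ p j)]
    (hn : ∀ j, 1 ≤ n j) (h : absInv (blockExp n p) ≤ 1) (j : Fin k) :
    Fact (1 ≤ p j / (n j : ℝ≥0∞)) := by
  refine ⟨one_le_of_toReal_inv_le_one ?_ ?_⟩
  · exact (ENNReal.div_pos (zero_lt_one.trans_le (hp j).out).ne' (ENNReal.natCast_ne_top _)).ne'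
  · rw [toReal_inv_div _ (hn j)]
    rw [absInv_blockExp] at h
    exact (Finset.single_le_sum (f := fun j => n j * ((p j)⁻¹).toReal)
      (fun j _ => by positivity) (Finset.mem_univ j)).trans h

theorem formBound_one {ρ : Fin k → ℝ} :
    FormBound ρ (fun _ : Fin k → Fin 1 => (1 : 𝕜)) 1 := by
  intro u ω hu hω
  simp only [Fintype.sum_unique, mul_one, one_mul, norm_prod]
  refine Finset.prod_le_prod (fun _ _ => norm_nonneg _) fun j _ => ?_
  simpa using norm_mul_rpow_le (hu j _) (hω j _)

/-- The diagonal restriction enters here, uniformly in N. -/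
theorem formBound_coeff {n : Fin k → ℕ} (hn : ∀ j, 1 ≤ n j) {p : Fin k → ℝ≥0∞}
    [∀ j, Fact (1 ≤ p j)] (T : BlockForm 𝕜 n p) (N : ℕ) :
    FormBound (fun j => ((p j / (n j : ℝ≥0∞))⁻¹).toReal)
      (fun i : Fin k → Fin N => T.coeff fun j => i j) ‖T‖ := by
  simp_rw [toReal_inv_div _ (hn _)]
  exact FormBound.diagonal (ρ := fun j => ((p j)⁻¹).toReal) hn
    (FormBound.of_continuousMultilinearMap T (fun s (x : Fin N) => X.e (x : ℕ))
      (fun s => ((p s.1)⁻¹).toReal) fun s => X.upperEstimate _ N)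

/-! ### The mixed-exponent constant -/

section ConstC

theorem constC_le (hk : 1 ≤ k) {r : Fin k → ℝ≥0∞} {q : Fin k → ℝ} (hR : absInv r ≤ 1 / 2)
    (hq : ∀ j, (1 - absInv r)⁻¹ ≤ q j ∧ q j ≤ 2)
    (hs : ∑ j, 1 / q j ≤ ((k : ℝ) + 1) / 2 - absInv r) :
    constC 𝕜 r q ≤ ENNReal.ofReal (√3 ^ k) := by
  refine sInf_le ?_
  intro _ A
  rw [← ofReal_norm, ← ENNReal.ofReal_mul (by positivity)]
  refine mixedSum_le_of_formBound hk (ρ := fun j => ((r j)⁻¹).toReal)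
    (fun j => ENNReal.toReal_nonneg) hR hq hs (norm_nonneg _) fun N => ?_
  exact FormBound.of_continuousMultilinearMap A (fun j (x : Fin N) => X.e (x : ℕ)) _
    fun j => X.upperEstimate _ N

/-- The product of first coordinates has norm at most 1 and a coefficient equal to 1. -/
theorem one_le_constC {r : Fin k → ℝ≥0∞} [∀ j, Fact (1 ≤ r j)] {q : Fin k → ℝ}
    (hq : ∀ j, 0 < q j) : 1 ≤ constC 𝕜 r q := by
  refine le_sInf fun C hC => ?_
  let A := coordForm (fun j (x : Fin 1) => X.coord 𝕜 (r j) x) fun _ => 1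
  have hA : ‖A‖ ≤ 1 := formBound_one.norm_coordForm_le (ρ := fun j => ((r j)⁻¹).toReal)
    (fun j => ENNReal.toReal_nonneg) zero_le_one _ fun j => X.lowerEstimate _ 1
  have hA1 : A (fun j => X.e 0) = 1 :=
    coordForm_basis (fun j (x : Fin 1) => X.coord 𝕜 (r j) x) (fun _ => 1)
      (fun j (x : Fin 1) => X.e (x : ℕ)) (fun j x y => by simp [X.coord_e, Subsingleton.elim x y]) 0
  have h1 := (le_mixedSum hq (fun i => ‖A fun j => X.e (i j)‖ₑ) 0).trans (hC A)
  simp only [Pi.zero_apply, hA1, enorm_one] at h1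
  refine h1.trans (mul_le_of_le_one_right' ?_)
  rw [← ofReal_norm, ← ENNReal.ofReal_one]
  exact ENNReal.ofReal_le_ofReal hA

theorem mixedSum_coeff_le {n : Fin k → ℕ} (hn : ∀ j, 1 ≤ n j) {p : Fin k → ℝ≥0∞}
    [∀ j, Fact (1 ≤ p j)] [∀ j, Fact (1 ≤ p j / (n j : ℝ≥0∞))] {q : Fin k → ℝ}
    (hq : ∀ j, 0 < q j) (hC : constC 𝕜 (fun j => p j / (n j : ℝ≥0∞)) q < ∞)
    (T : BlockForm 𝕜 n p) :
    mixedSum q (fun i => ‖T.coeff i‖ₑ) ≤ constC 𝕜 (fun j => p j / (n j : ℝ≥0∞)) q * ‖T‖ₑ := by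
  refine le_sInf_mul hC enorm_ne_top fun C hC => ?_
  refine mixedSum_le_of_truncate hq fun N => ?_
  let c : (Fin k → Fin N) → 𝕜 := fun i => T.coeff fun j => i j
  -- A genuine k-linear form with the truncated diagonal coefficients of T and norm at most ‖T‖, so
  -- every admissible C applies to it.
  let A := coordForm (fun j (x : Fin N) => X.coord 𝕜 (p j / (n j : ℝ≥0∞)) x) c
  have hA : ‖A‖ ≤ ‖T‖ := (formBound_coeff hn T N).norm_coordForm_le
    (fun j => ENNReal.toReal_nonneg) (norm_nonneg _) _ fun j => X.lowerEstimate _ N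
  have hAc : ∀ i : Fin k → Fin N, A (fun j => X.e (i j : ℕ)) = c i :=
    coordForm_basis (fun j (x : Fin N) => X.coord 𝕜 (p j / (n j : ℝ≥0∞)) x) c
      (fun j (x : Fin N) => X.e (x : ℕ)) fun j x y => by simp [X.coord_e, Fin.val_inj]
  refine (mixedSum_mono hq fun i => ?_).trans ((hC A).trans ?_)
  · simp only [truncate]
    split_ifs with h
    · exact le_of_eq (congrArg _ (hAc fun j => ⟨i j, h j⟩).symm)
    · exact zero_le
  · refine mul_le_mul_right ?_ _
    rw [← ofReal_norm, ← ofReal_norm]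
    exact ENNReal.ofReal_le_ofReal hA

end ConstC

/-! ### The constant for R ≥ 1/2 -/

section ConstD

theorem constD_le {r : Fin k → ℝ≥0∞} (hR : 1 / 2 ≤ absInv r) (hR1 : absInv r < 1) :
    constD 𝕜 r ≤ ENNReal.ofReal (√3 ^ k) := by
  refine sInf_le ?_
  intro _ N _ A
  have h := FormBound.of_continuousMultilinearMap A
    (fun j (x : Fin N) => WithLp.toLp (r j) (Pi.single x (1 : 𝕜))) (fun j => ((r j)⁻¹).toReal)
    fun j => PiLp.upperEstimate _
  have h1 := h.sum_norm_rpow_le (fun j => ENNReal.toReal_nonneg) hR hR1 (norm_nonneg _)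
  change (∑ i : Fin k → Fin N, ‖A fun j => WithLp.toLp (r j) (Pi.single (i j) (1 : 𝕜))‖ ^
    (1 / (1 - absInv r))) ^ (1 - absInv r) ≤ _ at h1
  have h0 : 0 < 1 - absInv r := by linarith
  simp_rw [← ofReal_norm]
  rw [← ENNReal.ofReal_mul (by positivity),
    Finset.sum_congr rfl fun i _ => ENNReal.ofReal_rpow_of_nonneg (norm_nonneg _) (by positivity),
    ← ENNReal.ofReal_sum_of_nonneg fun i _ => by positivity,
    ENNReal.ofReal_rpow_of_nonneg (Finset.sum_nonneg fun i _ => by positivity) h0.le]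
  exact ENNReal.ofReal_le_ofReal h1

theorem one_le_constD {r : Fin k → ℝ≥0∞} [∀ j, Fact (1 ≤ r j)] :
    1 ≤ constD 𝕜 r := by
  refine le_sInf fun C hC => ?_
  let A := coordForm (fun j (x : Fin 1) => PiLp.proj (r j) (fun _ : Fin 1 => 𝕜) (𝕜 := 𝕜) x)
    fun _ => 1
  have hA : ‖A‖ ≤ 1 := formBound_one.norm_coordForm_le (ρ := fun j => ((r j)⁻¹).toReal)
    (fun j => ENNReal.toReal_nonneg) zero_le_one _ fun j => PiLp.lowerEstimate _
  have hA1 : ∀ i : Fin k → Fin 1, A (fun j => WithLp.toLp (r j) (Pi.single (i j) (1 : 𝕜))) = 1 :=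
    coordForm_basis (fun j (x : Fin 1) => PiLp.proj (r j) (fun _ : Fin 1 => 𝕜) (𝕜 := 𝕜) x)
      (fun _ => 1) (fun j x => WithLp.toLp (r j) (Pi.single x (1 : 𝕜)))
      fun j x y => by simp
  have h1 := hC 1 one_pos A
  simp only [hA1, enorm_one, ENNReal.one_rpow, Fintype.sum_unique] at h1
  refine h1.trans (mul_le_of_le_one_right' ?_)
  rw [← ofReal_norm, ← ENNReal.ofReal_one]
  exact ENNReal.ofReal_le_ofReal hA

theorem exists_sum_le_sum_fin (g : (Fin k → ℕ) → ℝ≥0∞) (S : Finset (Fin k → ℕ)) :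
    ∃ N, 0 < N ∧ ∑ i ∈ S, g i ≤ ∑ i : Fin k → Fin N, g fun j => i j := by
  refine ⟨S.sup (fun i => Finset.univ.sup i) + 1, Nat.succ_pos _, ?_⟩
  set N := S.sup (fun i => Finset.univ.sup i) + 1 with hN
  have hlt : ∀ i ∈ S, ∀ j, i j < N := fun i hi j => Nat.lt_succ_of_le
    ((Finset.le_sup (Finset.mem_univ j)).trans (Finset.le_sup (f := fun i => Finset.univ.sup i) hi))
  have hsum : ∑' i, truncate N g i = ∑ i : Fin k → Fin N, g fun j => i j := by
    rw [tsum_pi_eq_sum_fin (N := N)]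
    · simp [truncate]
    · rintro i ⟨l, hl⟩
      exact if_neg fun h => absurd (h l) (not_lt.2 hl)
  rw [← hsum]
  refine le_trans (le_of_eq (Finset.sum_congr rfl fun i hi => ?_)) (ENNReal.sum_le_tsum S)
  exact (if_pos (hlt i hi)).symm

theorem tsum_coeff_le {n : Fin k → ℕ} (hn : ∀ j, 1 ≤ n j) {p : Fin k → ℝ≥0∞}
    [∀ j, Fact (1 ≤ p j)] [∀ j, Fact (1 ≤ p j / (n j : ℝ≥0∞))]
    (hR1 : absInv (fun j => p j / (n j : ℝ≥0∞)) < 1)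
    (hD : constD 𝕜 (fun j => p j / (n j : ℝ≥0∞)) < ∞) (T : BlockForm 𝕜 n p) :
    (∑' i : Fin k → ℕ, ‖T.coeff i‖ₑ ^ (1 / (1 - absInv fun j => p j / (n j : ℝ≥0∞)))) ^
        (1 - absInv fun j => p j / (n j : ℝ≥0∞)) ≤
      constD 𝕜 (fun j => p j / (n j : ℝ≥0∞)) * ‖T‖ₑ := by
  have h0 : 0 < 1 - absInv fun j => p j / (n j : ℝ≥0∞) := by linarith
  refine le_sInf_mul hD enorm_ne_top fun D hD => ?_
  rw [ENNReal.tsum_eq_iSup_sum, iSup_rpow _ h0]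
  refine iSup_le fun S => ?_
  obtain ⟨N, hN, hS⟩ := exists_sum_le_sum_fin
    (fun i => ‖T.coeff i‖ₑ ^ (1 / (1 - absInv fun j => p j / (n j : ℝ≥0∞)))) S
  refine (ENNReal.rpow_le_rpow hS h0.le).trans ?_
  let c : (Fin k → Fin N) → 𝕜 := fun i => T.coeff fun j => i j
  let φ : ∀ j, Fin N → PiLp (p j / (n j : ℝ≥0∞)) (fun _ : Fin N => 𝕜) →L[𝕜] 𝕜 := fun j x =>
    PiLp.proj (p j / (n j : ℝ≥0∞)) (fun _ : Fin N => 𝕜) (𝕜 := 𝕜) x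
  have hA : ‖coordForm φ c‖ ≤ ‖T‖ := (formBound_coeff hn T N).norm_coordForm_le
    (fun j => ENNReal.toReal_nonneg) (norm_nonneg _) _ fun j => PiLp.lowerEstimate _
  have hAc : ∀ i : Fin k → Fin N, coordForm φ c
      (fun j => WithLp.toLp (p j / (n j : ℝ≥0∞)) (Pi.single (i j) (1 : 𝕜))) = c i :=
    coordForm_basis φ c (fun j x => WithLp.toLp (p j / (n j : ℝ≥0∞)) (Pi.single x (1 : 𝕜)))
      fun j x y => by simp [φ]
  have h1 := hD N hN (coordForm φ c)
  simp_rw [hAc] at h1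
  refine h1.trans (mul_le_mul_right ?_ _)
  rw [← ofReal_norm, ← ofReal_norm]
  exact ENNReal.ofReal_le_ofReal hA

end ConstD

/-! ### Optimality of the exponent -/

section Optimality

/-- Hölder, with the constant function 1 taking up the missing weight 1-R; it contributes the power
of the cardinality. -/
theorem formBound_const {κ ι : Type*} [Fintype κ] [DecidableEq κ] [Fintype ι] [DecidableEq ι]
    {ρ : κ → ℝ} (hρ : ∀ j, 0 ≤ ρ j) (hR : ∑ j, ρ j ≤ 1) :
    FormBound ρ (fun i : κ → ι => ∑ x, if i = fun _ => x then (1 : 𝕜) else 0)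
      ((Fintype.card ι : ℝ) ^ (1 - ∑ j, ρ j)) := by
  intro u ω hu hω
  have h1 := sum_mul_prod_rpow_le Finset.univ (fun _ : ι => (1 : ℝ)) u (1 - ∑ j, ρ j) ρ
    (fun _ => zero_le_one) hu (sub_nonneg.2 hR) hρ (by ring)
  simp only [Real.one_rpow, one_mul, Finset.sum_const, Finset.card_univ, nsmul_eq_mul,
    mul_one] at h1
  refine le_trans ?_ h1
  simp_rw [Finset.mul_sum]
  rw [Finset.sum_comm]
  refine norm_sum_le_of_le _ fun x _ => ?_
  simp only [mul_ite, mul_one, mul_zero, Finset.sum_ite_eq', Finset.mem_univ, if_true, norm_prod]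
  exact Finset.prod_le_prod (fun _ _ => norm_nonneg _) fun j _ => norm_mul_rpow_le (hu j x) (hω j x)

/-- The test form is ∑_{x<N} ∏_s v_s(x). Letting N grow in this inequality forces 1/s ≤ 1-R. -/
theorem natCast_rpow_le_of_coeff_le (hk : 1 ≤ k) {n : Fin k → ℕ} (hn : ∀ j, 1 ≤ n j)
    {p : Fin k → ℝ≥0∞} [∀ j, Fact (1 ≤ p j)] (hR1 : absInv (blockExp n p) ≤ 1) {s : ℝ}
    (hs : 0 < s) {K : ℝ≥0∞} (hK : K < ∞)
    (h : ∀ T : BlockForm 𝕜 n p, (∑' i : Fin k → ℕ, ‖T.coeff i‖ₑ ^ s) ^ (1 / s) ≤ K * ‖T‖ₑ)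
    (N : ℕ) : (N : ℝ) ^ (1 / s) ≤ K.toReal * (N : ℝ) ^ (1 - absInv (blockExp n p)) := by
  let j₀ : Fin k := ⟨0, hk⟩
  -- At least one slot is needed for distinct x to give distinct constant multi-indices.
  let s₀ : Σ j, Fin (n j) := ⟨j₀, ⟨0, hn j₀⟩⟩
  let c : ((Σ j, Fin (n j)) → Fin N) → 𝕜 := fun i => ∑ x, if i = fun _ => x then 1 else 0
  let T : BlockForm 𝕜 n p := coordForm (fun s (x : Fin N) => X.coord 𝕜 (blockExp n p s) x) c
  have hT : ‖T‖ ≤ (N : ℝ) ^ (1 - absInv (blockExp n p)) := by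
    have := formBound_const (𝕜 := 𝕜) (ι := Fin N)
      (ρ := fun s => ((blockExp n p s)⁻¹).toReal) (fun s => ENNReal.toReal_nonneg) hR1
    rw [Fintype.card_fin] at this
    exact this.norm_coordForm_le (fun s => ENNReal.toReal_nonneg) (by positivity) _
      fun s => X.lowerEstimate _ N
  have hTc : ∀ x : Fin N, T.coeff (fun _ => (x : ℕ)) = 1 := by
    intro x
    have h1 : T.coeff (fun _ => (x : ℕ)) = c fun _ => x :=
      coordForm_basis (fun s (x : Fin N) => X.coord 𝕜 (blockExp n p s) x) c
        (fun s (x : Fin N) => X.e (x : ℕ)) (fun s x y => by simp [X.coord_e, Fin.val_inj])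
        fun _ => x
    rw [h1]
    have h2 : ∀ y : Fin N, ((fun _ => x) = fun _ : (Σ j, Fin (n j)) => y) ↔ x = y :=
      fun y => ⟨fun h => congrFun h s₀, fun h => h ▸ rfl⟩
    simp [c, h2, Finset.filter_eq]
  have hsum : (N : ℝ≥0∞) ≤ ∑' i : Fin k → ℕ, ‖T.coeff i‖ₑ ^ s := by
    have hinj : Function.Injective fun (x : Fin N) (_ : Fin k) => (x : ℕ) :=
      fun x y hxy => Fin.ext (congrFun hxy j₀)
    refine le_trans ?_ (ENNReal.tsum_comp_le_tsum_of_injective hinj _)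
    simp [tsum_fintype, hTc]
  have h1 := (ENNReal.rpow_le_rpow hsum (by positivity)).trans (h T)
  rw [← ofReal_norm] at h1
  have h2 := h1.trans (mul_le_mul_right (ENNReal.ofReal_le_ofReal hT) K)
  have h3 := ENNReal.toReal_mono (ENNReal.mul_ne_top hK.ne ENNReal.ofReal_ne_top) h2
  rwa [← ENNReal.toReal_rpow, ENNReal.toReal_natCast, ENNReal.toReal_mul,
    ENNReal.toReal_ofReal (by positivity)] at h3

theorem le_of_forall_natCast_rpow_le {a b K : ℝ}
    (h : ∀ N : ℕ, (N : ℝ) ^ a ≤ K * (N : ℝ) ^ b) : a ≤ b := by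
  by_contra hab
  push Not at hab
  have ht := (tendsto_rpow_atTop (sub_pos.2 hab)).comp tendsto_natCast_atTop_atTop
  obtain ⟨N, hN, hN0⟩ := ((ht.eventually_gt_atTop K).and (Filter.eventually_gt_atTop 0)).exists
  have hN0' : (0 : ℝ) < N := by exact_mod_cast hN0
  simp only [Function.comp_apply, Real.rpow_sub hN0'] at hN
  rw [lt_div_iff₀ (by positivity)] at hN
  exact absurd (h N) (not_le.2 hN)

end Optimality

end Bounds

end HardyLittlewood

theorem mainTheorem10 (𝕜 : Type*) [RCLike 𝕜] (k : ℕ) (hk : 1 ≤ k)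
    (n : Fin k → ℕ) (hn : ∀ j, 1 ≤ n j)
    (p : Fin k → ℝ≥0∞) [∀ j, Fact (1 ≤ p j)] :
    (HardyLittlewood.absInv (HardyLittlewood.blockExp n p) ≤ 1 / 2 →
      ∀ q : Fin k → ℝ,
        (∀ j, (1 - HardyLittlewood.absInv (HardyLittlewood.blockExp n p))⁻¹ ≤ q j ∧ q j ≤ 2) →
        ∑ j, 1 / q j ≤
          ((k : ℝ) + 1) / 2 - HardyLittlewood.absInv (HardyLittlewood.blockExp n p) →
        1 ≤ HardyLittlewood.constC 𝕜 (fun j => p j / (n j : ℝ≥0∞)) q ∧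
        HardyLittlewood.constC 𝕜 (fun j => p j / (n j : ℝ≥0∞)) q < ∞ ∧
        ∀ T : HardyLittlewood.BlockForm 𝕜 n p,
          HardyLittlewood.mixedSum q (fun i => ‖HardyLittlewood.BlockForm.coeff T i‖ₑ) ≤
            HardyLittlewood.constC 𝕜 (fun j => p j / (n j : ℝ≥0∞)) q * ‖T‖ₑ) ∧
    (1 / 2 ≤ HardyLittlewood.absInv (HardyLittlewood.blockExp n p) →
      HardyLittlewood.absInv (HardyLittlewood.blockExp n p) < 1 →
        1 ≤ HardyLittlewood.constD 𝕜 (fun j => p j / (n j : ℝ≥0∞)) ∧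
        HardyLittlewood.constD 𝕜 (fun j => p j / (n j : ℝ≥0∞)) < ∞ ∧
        (∀ T : HardyLittlewood.BlockForm 𝕜 n p,
          (∑' i : Fin k → ℕ, ‖HardyLittlewood.BlockForm.coeff T i‖ₑ ^
              (1 / (1 - HardyLittlewood.absInv (HardyLittlewood.blockExp n p))))
            ^ (1 - HardyLittlewood.absInv (HardyLittlewood.blockExp n p)) ≤
            HardyLittlewood.constD 𝕜 (fun j => p j / (n j : ℝ≥0∞)) * ‖T‖ₑ) ∧
        IsLeast {s : ℝ | 0 < s ∧ ∃ K : ℝ≥0∞, K < ∞ ∧ ∀ T : HardyLittlewood.BlockForm 𝕜 n p,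
            (∑' i : Fin k → ℕ, ‖HardyLittlewood.BlockForm.coeff T i‖ₑ ^ s) ^ (1 / s) ≤
              K * ‖T‖ₑ}
          (1 / (1 - HardyLittlewood.absInv (HardyLittlewood.blockExp n p)))) := by
  open HardyLittlewood in
  have hR : absInv (fun j => p j / (n j : ℝ≥0∞)) = absInv (blockExp n p) := by
    rw [absInv_blockExp]
    exact Finset.sum_congr rfl fun j _ => toReal_inv_div _ (hn j) _
  refine ⟨fun hle q hq hs => ?_, fun hge hlt => ?_⟩
  · have := fact_one_le_div hn (hle.trans (by norm_num))
    have hq0 : ∀ j, 0 < q j := fun j =>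
      (inv_pos.2 (by linarith : 0 < 1 - absInv (blockExp n p))).trans_le (hq j).1
    rw [← hR] at hle hq hs
    have hC := (constC_le (𝕜 := 𝕜) hk hle hq hs).trans_lt ENNReal.ofReal_lt_top
    exact ⟨one_le_constC hq0, hC, mixedSum_coeff_le hn hq0 hC⟩
  · have := fact_one_le_div hn hlt.le
    have hD := (constD_le (𝕜 := 𝕜) (hR ▸ hge) (hR ▸ hlt)).trans_lt ENNReal.ofReal_lt_top
    have hT := tsum_coeff_le hn (hR ▸ hlt) hD
    rw [hR] at hT
    refine ⟨one_le_constD, hD, hT, ⟨one_div_pos.2 (by linarith), _, hD, fun T => ?_⟩, ?_⟩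
    · rw [one_div_one_div]
      exact hT T
    · rintro s ⟨hs, K, hK, h⟩
      have := le_of_forall_natCast_rpow_le (natCast_rpow_le_of_coeff_le hk hn hlt.le hs hK h)
      rwa [one_div_le (by linarith) hs]
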